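/- Let $n\ge 1$ and let $R$ be the root system of type $B_n$ or $C_n$, realized in $\mathbb R^n$ with standard basis $\varepsilon_1,\dots,\varepsilon_n$ and with simple roots numbered so that $\alpha_1$ is the special node: $\alpha_1=\varepsilon_1$ in type $B_n$, $\alpha_1=2\varepsilon_1$ in type $C_n$, and $\alpha_i=\varepsilon_i-\varepsilon_{i-1}$ for $2\le i\le n$. The Weyl group $W$ is generated by the simple reflections $s_1,\dots,s_n$; an element $w\in W$ is written as a signed permutation $w=(w(1),\dots,w(n))$, where $w(\varepsilon_k)=\varepsilon_{w(k)}$ and $\varepsilon_{-a}=-\varepsilon_a$. Let $\omega_1,\dots,\omega_n$ be the fundamental weights, $1\le r\le n$, $I_r=\{\alpha_r\}$, and let $W^{I_r}$ be the set of $w\in W$ such that $w(\alpha_j)$ is a positive root for all $j\ne r$, ordered by the Bruhat order. For a weight $\mu$, write $\mu\ge 0$ if $\mu$ is a linear combination of simple roots with nonnegative real coefficients. Call $v\in W^{I_r}$ *maximal* if it is a maximal element of $\{v\in W^{I_r}: v(\omega_r)\ge 0\}$ in the Bruhat order. For integers $s\le t$ and $m\ge 0$ let $J_{m,[s,t]}$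 be the set of sequences $\underline i=(i_1,\dots,i_m)$ of integers in $[s,t]$ with $i_{k+1}-i_k\ge 2$ for all $k$; put $\underline i'=(i_1-1,\dots,i_m-1)$, $-\underline i'=(-(i_m-1),\dots,-(i_1-1))$, $[\underline i]=\{i_1,\dots,i_m\}$, and let $S{\uparrow}$ be the elements of a finite set $S$ of integers in increasing order. The maximal elements are the following, both in type $B_n$ and in type $C_n$. (i) If $r=1$, there is exactly one maximal element, namely $$v=\begin{cases}(-(n-1),-(n-3),\dots,-3,-1,2,4,\dots,n-2,n), & n\text{ even},\\ (-(n-1),-(n-3),\dots,-4,-2,1,3,5,\dots,n-2,n), & n\text{ odd}.\end{cases}$$ (ii) Let $2\le r\le n-1$ and $n+1-r=2m$. For every $\underline i\in J_{m,[2,n]}$ there is a unique $v_{\underline i}\in W^{I_r}$ with $v_{\underline i}(\omega_r)=\sum_{k=1}^m\alpha_{i_k}$; it is maximal, and $$v_{\underline i}=\bigl(([1,n]\setminus([\underline i]\cup[\underline i'])){\uparrow},\,-\underline i',\,\underline i\bigr).$$ Every maximal element equals $v_{\underline i}$ for exactly one $\underline i\in J_{m,[2,n]}$. (iii) Let $2\le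 r\le n-1$ and $n+1-r=2m+1$. For every $\underline i\in J_{m,[3,n]}$ there is a unique $v_{\underline i}\in W^{I_r}$ with $v_{\underline i}(\omega_r)=\alpha_1+\sum_{k=1}^m\alpha_{i_k}$ in type $B_n$, respectively $v_{\underline i}(\omega_r)=\tfrac12\alpha_1+\sum_{k=1}^m\alpha_{i_k}$ in type $C_n$; it is maximal, and $$v_{\underline i}=\bigl(([1,n]\setminus(\{1\}\cup[\underline i]\cup[\underline i'])){\uparrow},\,-\underline i',\,1,\,\underline i\bigr).$$ Every maximal element equals $v_{\underline i}$ for exactly one $\underline i\in J_{m,[3,n]}$. (iv) If $r=n$, there is exactly one maximal element, namely $v=(2,3,4,\dots,n-1,n,1)$. -/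

import Mathlib

namespace TypeBC

/-- The two types of root systems under consideration. -/
inductive Kind
  | B
  | C

/-- The real vector space `X(T) ⊗ ℝ`, with its standard Weyl-invariant inner product. -/
abbrev E (n : ℕ) := EuclideanSpace ℝ (Fin n)

/-- The vectors `ε_a` for `a ∈ {±1, …, ±n}`: `ε_1, …, ε_n` is the standard basis (the index `j` of
`Fin n` stands for the coordinate number `j + 1`), and `ε_{-a} = -ε_a`. -/
noncomputable def eps (n : ℕ) (a : ℤ) : E n :=
  WithLp.toLp 2 fun j : Fin n =>
    if a = (j : ℤ) + 1 then 1 else if a = -((j : ℤ) + 1) then -1 else 0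

/-- The simple roots `α_1, …, α_n`, where `α_1` is the special node of the Dynkin diagram:
`α_1 = ε_1` in type `B_n`, `α_1 = 2 ε_1` in type `C_n`, and `α_i = ε_i - ε_{i-1}` for `i ≥ 2`. -/
noncomputable def simpleRoot (t : Kind) (n : ℕ) (i : ℤ) : E n :=
  if i = 1 then
    match t with
    | .B => eps n 1
    | .C => (2 : ℝ) • eps n 1
  else eps n i - eps n (i - 1)

/-- The positive roots `R⁺`: `ε_j ± ε_i` for `1 ≤ i < j ≤ n`, together with `ε_i` (type `B_n`) or
`2 ε_i` (type `C_n`) for `1 ≤ i ≤ n`. -/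
def IsPosRoot (t : Kind) (n : ℕ) (β : E n) : Prop :=
  (∃ i : ℤ, 1 ≤ i ∧ i ≤ n ∧
    β = match t with
      | .B => eps n i
      | .C => (2 : ℝ) • eps n i) ∨
  ∃ i j : ℤ, 1 ≤ i ∧ i < j ∧ j ≤ n ∧ (β = eps n j - eps n i ∨ β = eps n j + eps n i)

/-- The number `⟨χ, α^∨⟩ = 2 (χ, α) / (α, α)`. -/
noncomputable def corootPairing {n : ℕ} (χ α : E n) : ℝ :=
  2 * inner ℝ χ α / inner ℝ α α

/-- The reflection `s_α`, as a linear isometry. -/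
noncomputable def refl {n : ℕ} (α : E n) : E n ≃ₗᵢ[ℝ] E n :=
  (Submodule.span ℝ {α})ᗮ.reflection

theorem refl_apply {n : ℕ} (α χ : E n) : refl α χ = χ - corootPairing χ α • α := by
  unfold refl corootPairing
  rw [Submodule.reflection_orthogonal_apply, Submodule.reflection_singleton_apply,
    real_inner_self_eq_norm_sq, real_inner_comm]
  simp only [RCLike.ofReal_real_eq_id, id_eq, neg_sub, two_smul, ← add_smul]
  congr 2
  ring

/-- The fundamental weight `ω_r`: `ω_r = ε_r + ⋯ + ε_n`, except that
`ω_1 = ½ (ε_1 + ⋯ + ε_n)` in type `B_n`. See `corootPairing_fundWeight` for `⟨ω_r, α_j^∨⟩ = δ_{rj}`. -/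
noncomputable def fundWeight (t : Kind) (n : ℕ) (r : ℤ) : E n :=
  match t with
  | .B => if r = 1 then (1 / 2 : ℝ) • ∑ k ∈ Finset.Icc (1 : ℤ) n, eps n k
      else ∑ k ∈ Finset.Icc r (n : ℤ), eps n k
  | .C => ∑ k ∈ Finset.Icc r (n : ℤ), eps n k

theorem eps_succ (n : ℕ) (j : Fin n) : eps n ((j : ℤ) + 1) = EuclideanSpace.single j (1 : ℝ) := by
  ext k
  simp only [eps, PiLp.single_apply]
  by_cases h : k = j
  · simp [h]
  · have h1 : (k : ℤ) ≠ j := by simpa [Fin.ext_iff] using h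
    have h2 : ¬ ((j : ℤ) + 1 = k + 1) := by omega
    have h3 : ¬ ((j : ℤ) + 1 = -((k : ℤ) + 1)) := by omega
    rw [if_neg h2, if_neg h3, if_neg h]

theorem inner_eps (n : ℕ) (a b : ℤ) (ha : 1 ≤ a) (han : a ≤ n) (hb : 1 ≤ b) (hbn : b ≤ n) :
    inner ℝ (eps n a) (eps n b) = if a = b then (1 : ℝ) else 0 := by
  obtain ⟨x, hx⟩ : ∃ x : Fin n, (x : ℤ) + 1 = a := ⟨⟨(a - 1).toNat, by omega⟩, by simp only; omega⟩
  obtain ⟨y, hy⟩ : ∃ y : Fin n, (y : ℤ) + 1 = b := ⟨⟨(b - 1).toNat, by omega⟩, by simp only; omega⟩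
  rw [← hx, ← hy, eps_succ, eps_succ]
  simp [Fin.ext_iff, EuclideanSpace.inner_single_left]

theorem inner_eps_sum (n : ℕ) (r b : ℤ) (hr : 1 ≤ r) (hb : 1 ≤ b) (hbn : b ≤ n) :
    inner ℝ (∑ k ∈ Finset.Icc r (n : ℤ), eps n k) (eps n b) = if r ≤ b then (1 : ℝ) else 0 := by
  have key : ∀ k ∈ Finset.Icc r (n : ℤ),
      inner ℝ (eps n k) (eps n b) = if k = b then (1 : ℝ) else 0 := by
    intro k hk
    rw [Finset.mem_Icc] at hk
    exact inner_eps n k b (by omega) hk.2 hb hbn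
  rw [sum_inner, Finset.sum_congr rfl key, Finset.sum_ite_eq']
  simp [hbn]

/-- The defining property `⟨ω_r, α_j^∨⟩ = δ_{rj}` of the fundamental weights. -/
theorem corootPairing_fundWeight (t : Kind) (n : ℕ) (r j : ℤ) (hr : 1 ≤ r) (hrn : r ≤ n)
    (hj : 1 ≤ j) (hjn : j ≤ n) :
    corootPairing (fundWeight t n r) (simpleRoot t n j) = if r = j then 1 else 0 := by
  have h11 := inner_eps n 1 1 (by omega) (by omega) (by omega) (by omega)
  by_cases h1 : j = 1
  · subst h1
    have hs := inner_eps_sum n r 1 hr (by omega) (by omega)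
    have hs1 := inner_eps_sum n 1 1 (by omega) (by omega) (by omega)
    by_cases h2 : r = 1
    · subst h2
      cases t <;>
        simp [-inner_self_eq_norm_sq_to_K, corootPairing, fundWeight, simpleRoot, inner_smul_left, inner_smul_right, h11, hs1]
    · have h3 : ¬ r ≤ 1 := by omega
      cases t <;>
        simp [-inner_self_eq_norm_sq_to_K, corootPairing, fundWeight, simpleRoot, inner_smul_left, inner_smul_right, h2, h3,
          hs]
  · have e1 := inner_eps n j j (by omega) (by omega) (by omega) (by omega)
    have e2 := inner_eps n (j - 1) (j - 1) (by omega) (by omega) (by omega) (by omega)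
    have e3 := inner_eps n j (j - 1) (by omega) (by omega) (by omega) (by omega)
    have e4 := inner_eps n (j - 1) j (by omega) (by omega) (by omega) (by omega)
    have s1 := inner_eps_sum n r j hr (by omega) (by omega)
    have s2 := inner_eps_sum n r (j - 1) hr (by omega) (by omega)
    have hd : inner ℝ (eps n j - eps n (j - 1)) (eps n j - eps n (j - 1)) = (2 : ℝ) := by
      rw [if_pos rfl] at e1 e2
      rw [if_neg (by omega)] at e3 e4
      simp only [inner_sub_left, inner_sub_right, e1, e2, e3, e4]
      norm_num
    have hn : inner ℝ (∑ k ∈ Finset.Icc r (n : ℤ), eps n k) (eps n j - eps n (j - 1)) =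
        if r = j then (1 : ℝ) else 0 := by
      rw [inner_sub_right, s1, s2]
      split_ifs <;> first | omega | norm_num
    by_cases h2 : r = 1
    · subst h2
      cases t <;>
        simp [-inner_self_eq_norm_sq_to_K, corootPairing, fundWeight, simpleRoot, inner_smul_left, h1, hd, hn, Ne.symm h1]
    · cases t <;> simp [-inner_self_eq_norm_sq_to_K, corootPairing, fundWeight, simpleRoot, h1, h2, hd, hn] <;>
        split_ifs <;> norm_num

/-- The Weyl group `W`, generated by the simple reflections `s_1, …, s_n`. -/
noncomputable def weylGroup (t : Kind) (n : ℕ) : Subgroup (E n ≃ₗᵢ[ℝ] E n) :=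
  Subgroup.closure {s | ∃ i : ℤ, 1 ≤ i ∧ i ≤ n ∧ s = refl (simpleRoot t n i)}

/-- The length `ℓ(w)`: the least number of factors in an expression of `w` as a product of simple
reflections. -/
noncomputable def coxeterLength {t : Kind} {n : ℕ} (w : weylGroup t n) : ℕ :=
  sInf {k | ∃ l : List ℤ, l.length = k ∧ (∀ i ∈ l, 1 ≤ i ∧ i ≤ n) ∧
    (w : E n ≃ₗᵢ[ℝ] E n) = (l.map fun i => refl (simpleRoot t n i)).prod}

/-- One step up in the Bruhat order: `w = s_β u` for a positive root `β`, and `ℓ(u) < ℓ(w)`. -/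
def BruhatStep {t : Kind} {n : ℕ} (u w : weylGroup t n) : Prop :=
  ∃ β : E n, IsPosRoot t n β ∧ (w : E n ≃ₗᵢ[ℝ] E n) = refl β * u ∧ coxeterLength u < coxeterLength w

/-- The Bruhat order `u ≤ w` on the Weyl group. -/
def BruhatLE {t : Kind} {n : ℕ} (u w : weylGroup t n) : Prop :=
  Relation.ReflTransGen BruhatStep u w

/-- The set `W^{I_r}`, with `I_r = {α_r}`: all `w ∈ W` such that `w(α_j)` is a positive root for every
simple root `α_j ≠ α_r`. -/
def minReps (t : Kind) (n : ℕ) (r : ℤ) : Set (weylGroup t n) :=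
  {w | ∀ j : ℤ, 1 ≤ j → j ≤ n → j ≠ r → IsPosRoot t n (w.1 (simpleRoot t n j))}

/-- `μ ≥ 0`: the vector `μ` is a linear combination of the simple roots with nonnegative real
coefficients. -/
def NonnegWeight (t : Kind) (n : ℕ) (μ : E n) : Prop :=
  ∃ c : ℤ → ℝ, (∀ j, 0 ≤ c j) ∧ μ = ∑ j ∈ Finset.Icc (1 : ℤ) n, c j • simpleRoot t n j

/-- The set of all `v ∈ W^{I_r}` that are maximal (in the Bruhat order on `W^{I_r}`) with the property
`v(ω_r) ≥ 0`. -/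
def maximalElements (t : Kind) (n : ℕ) (r : ℤ) : Set (weylGroup t n) :=
  {v | v ∈ minReps t n r ∧ NonnegWeight t n (v.1 (fundWeight t n r)) ∧
    ∀ u ∈ minReps t n r, NonnegWeight t n (u.1 (fundWeight t n r)) → BruhatLE v u → u = v}

/-- `w = (a_1, …, a_n)` as a signed permutation: `w(k) = a_k`, that is, `w(ε_k) = ε_{a_k}` for
`1 ≤ k ≤ n`. (The list `a` is indexed from `0`.) -/
def IsWindow {t : Kind} {n : ℕ} (w : weylGroup t n) (a : List ℤ) : Prop :=
  a.length = n ∧ ∀ (k : ℕ) (hk : k < a.length), w.1 (eps n ((k : ℤ) + 1)) = eps n a[k]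

/-- The set `J_{p,[s,t]}` of sequences `(i_1, …, i_p)` in `[s,t]` with `i_{k+1} - i_k ≥ 2`. -/
def gapSeqs (p : ℕ) (s t : ℤ) : Set (List ℤ) :=
  {i | i.length = p ∧ (∀ x ∈ i, s ≤ x ∧ x ≤ t) ∧ i.IsChain fun x y => 2 ≤ y - x}

/-- The sequence `i' = (i_1 - 1, …, i_m - 1)`. -/
def predSeq (i : List ℤ) : List ℤ := i.map fun x => x - 1

/-- The sequence `-i = (-i_m, …, -i_1)`. -/
def negRev (i : List ℤ) : List ℤ := (i.map fun x => -x).reverse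

/-- The window `([1,n] ∖ {[i],[i']} ↑, -i', i)`. -/
noncomputable def windowEven (n : ℕ) (i : List ℤ) : List ℤ :=
  (Finset.Icc (1 : ℤ) n \ (i.toFinset ∪ (predSeq i).toFinset)).sort (· ≤ ·) ++ negRev (predSeq i) ++ i

/-- The window `([1,n] ∖ {1,[i],[i']} ↑, -i', 1, i)`. -/
noncomputable def windowOdd (n : ℕ) (i : List ℤ) : List ℤ :=
  (Finset.Icc (1 : ℤ) n \ ({1} ∪ i.toFinset ∪ (predSeq i).toFinset)).sort (· ≤ ·) ++
    negRev (predSeq i) ++ [1] ++ i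

/-- The weight `∑_k α_{i_k}`. -/
noncomputable def rootSum (t : Kind) (n : ℕ) (i : List ℤ) : E n :=
  (i.map (simpleRoot t n)).sum

/-- The coefficient of `α_1` in the odd case: `1` in type `B_n`, and `½` in type `C_n`. -/
noncomputable def alphaOneCoeff : Kind → ℝ
  | .B => 1
  | .C => 1 / 2

end TypeBC

/-! Up to scaling, `ω_r` is `ε_r + ⋯ + ε_n`, so `v ∈ W^{I_r}` is determined by the vector
`v(ω_r) ∈ {-1, 0, 1}ⁿ`, which has `n + 1 - r` nonzero coordinates. Write `v(ω_r) = ∑ c_j α_j`.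
Since going up in the Bruhat order lowers the `c_j`, a maximal `v` is one for which no reflection
lowers `v(ω_r)` within the cone `c ≥ 0`; this forces `c_j ∈ {0, 1}` with no two consecutive `c_j`
equal to `1`, so that `v(ω_r)` is a sum of pairwise orthogonal simple roots. Conversely, if
`v(ω_r)` is such a sum over `T`, any `u ≥ v` with `u(ω_r) ≥ 0` has `u(ω_r)` a sum over some
`S ⊆ T`, and counting nonzero coordinates gives `S = T`. -/

namespace TypeBC

variable {t : Kind} {n : ℕ}

theorem eps_neg (n : ℕ) (a : ℤ) : eps n (-a) = -eps n a := by
  ext k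
  simp only [eps, PiLp.neg_apply]
  split_ifs <;> first | omega | norm_num

theorem eps_zero (n : ℕ) : eps n 0 = 0 := by
  ext j
  simp only [eps, PiLp.zero_apply]
  rw [if_neg (by omega), if_neg (by omega)]

theorem exists_fin_add_one_eq {a : ℤ} (ha : 1 ≤ a) (han : a ≤ n) : ∃ j : Fin n, (j : ℤ) + 1 = a :=
  ⟨⟨(a - 1).toNat, by omega⟩, by simp only; omega⟩

theorem inner_eps_eps {b : ℤ} (hb : b ≠ 0) (hbn : b.natAbs ≤ n) (a : ℤ) :
    inner ℝ (eps n a) (eps n b) = if a = b then (1 : ℝ) else if a = -b then -1 else 0 := by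
  wlog hpos : 0 < b generalizing a b
  · rw [← neg_neg b, eps_neg, inner_neg_right, this (by omega) (by omega) _ (by omega)]
    split_ifs <;> first | omega | norm_num
  obtain ⟨j, rfl⟩ := exists_fin_add_one_eq (n := n) (a := b) (by omega) (by omega)
  rw [eps_succ, EuclideanSpace.inner_single_right]
  simp [eps]

theorem ext_inner_eps {x y : E n}
    (h : ∀ a : ℤ, 1 ≤ a → a ≤ n → inner ℝ x (eps n a) = inner ℝ y (eps n a)) : x = y := by
  ext j
  simpa [eps_succ, EuclideanSpace.inner_single_right] using h (j + 1) (by omega) (by omega)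

theorem eps_eq_zero_of_lt_natAbs {a : ℤ} (ha : n < a.natAbs) : eps n a = 0 := by
  ext j
  simp only [eps, PiLp.zero_apply]
  rw [if_neg (by omega), if_neg (by omega)]

/-- A finite set of indices of vectors `ε_a`, containing at most one of `a` and `-a` for every `a`:
these sets encode the vectors with all coordinates in `{-1, 0, 1}`. -/
def IsSignedSet (n : ℕ) (P : Finset ℤ) : Prop :=
  ∀ a ∈ P, a.natAbs ≤ n ∧ -a ∉ P

/-- The vector `∑_{a ∈ P} ε_a`. -/
noncomputable def epsSum (n : ℕ) (P : Finset ℤ) : E n := ∑ a ∈ P, eps n a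

theorem inner_epsSum_eps {P : Finset ℤ} (hP : IsSignedSet n P) (a : ℤ) :
    inner ℝ (epsSum n P) (eps n a) = if a ∈ P then (1 : ℝ) else if -a ∈ P then -1 else 0 := by
  by_cases ha : a ≠ 0 ∧ a.natAbs ≤ n
  · have hterm (b : ℤ) : inner ℝ (eps n b) (eps n a) =
        (if b = a then (1 : ℝ) else 0) + if b = -a then -1 else 0 := by
      rw [inner_eps_eps ha.1 ha.2]
      split_ifs <;> first | omega | norm_num
    simp only [epsSum, sum_inner, hterm, Finset.sum_add_distrib, Finset.sum_ite_eq']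
    grind [IsSignedSet]
  · have heps : eps n a = 0 := by
      rcases eq_or_ne a 0 with rfl | h0
      exacts [eps_zero n, eps_eq_zero_of_lt_natAbs (by omega)]
    rw [heps, inner_zero_right]
    grind [IsSignedSet]

theorem IsSignedSet.mem_iff {P : Finset ℤ} (hP : IsSignedSet n P) {a : ℤ} :
    a ∈ P ↔ 0 < inner ℝ (epsSum n P) (eps n a) := by
  rw [inner_epsSum_eps hP]
  split_ifs <;> simp_all

theorem IsSignedSet.eq_of_epsSum_eq {P Q : Finset ℤ} (hP : IsSignedSet n P) (hQ : IsSignedSet n Q)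
    (h : epsSum n P = epsSum n Q) : P = Q := by
  ext a
  rw [hP.mem_iff, hQ.mem_iff, h]

/-- The vector `ε_r + ⋯ + ε_n`; it is the fundamental weight `ω_r`, up to the factor `½` that
occurs for `r = 1` in type `B_n`. -/
noncomputable def tailVec (n : ℕ) (r : ℤ) : E n := epsSum n (Finset.Icc r n)

theorem isSignedSet_Icc {r : ℤ} (hr : 1 ≤ r) : IsSignedSet n (Finset.Icc r n) := fun a ha => by
  simp only [Finset.mem_Icc] at ha ⊢
  omega

theorem inner_tailVec_eps {r a : ℤ} (hr : 1 ≤ r) (ha : a.natAbs ≤ n) :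
    inner ℝ (tailVec n r) (eps n a) = if r ≤ a then (1 : ℝ) else if a ≤ -r then -1 else 0 := by
  rw [tailVec, inner_epsSum_eps (isSignedSet_Icc hr)]
  simp only [Finset.mem_Icc]
  split_ifs <;> first | omega | rfl

theorem tailVec_eq_eps_add {j : ℤ} (hj : j ≤ n) : tailVec n j = eps n j + tailVec n (j + 1) := by
  rw [tailVec, tailVec, epsSum, epsSum, ← Finset.insert_Icc_add_one_left_eq_Icc hj,
    Finset.sum_insert (by simp)]

theorem tailVec_of_lt {j : ℤ} (hj : n < j) : tailVec n j = 0 := by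
  rw [tailVec, epsSum, Finset.Icc_eq_empty (by omega), Finset.sum_empty]

theorem ext_inner_tailVec {x y : E n}
    (h : ∀ j : ℤ, 1 ≤ j → inner ℝ x (tailVec n j) = inner ℝ y (tailVec n j)) : x = y :=
  ext_inner_eps fun a ha han => by
    rw [eq_sub_of_add_eq (tailVec_eq_eps_add han).symm, inner_sub_right, inner_sub_right, h a ha,
      h (a + 1) (by omega)]

/-- The ratio of `ω_r` to `ε_r + ⋯ + ε_n`. -/
noncomputable def weightScale : Kind → ℤ → ℝ
  | .B, r => if r = 1 then 1 / 2 else 1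
  | .C, _ => 1

theorem weightScale_pos (t : Kind) (r : ℤ) : 0 < weightScale t r := by
  cases t <;> simp only [weightScale]
  · split_ifs <;> norm_num
  · norm_num

theorem weightScale_of_ne_one {r : ℤ} (hr : r ≠ 1) : weightScale t r = 1 := by
  cases t <;> simp [weightScale, hr]

theorem fundWeight_eq_smul (t : Kind) (n : ℕ) (r : ℤ) :
    fundWeight t n r = weightScale t r • tailVec n r := by
  cases t
  · by_cases h : r = 1 <;> simp [fundWeight, weightScale, tailVec, epsSum, h]
  · simp [fundWeight, weightScale, tailVec, epsSum]

/-- The vector `∑ k ε_k`, which pairs positively with every positive root. -/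
noncomputable def rho (n : ℕ) : E n := ∑ k ∈ Finset.Icc (1 : ℤ) n, (k : ℝ) • eps n k

theorem inner_rho_eps {a : ℤ} (ha : a.natAbs ≤ n) : inner ℝ (rho n) (eps n a) = a := by
  have inner_rho_of_pos {b : ℤ} (hb : 1 ≤ b) (hbn : b ≤ n) : inner ℝ (rho n) (eps n b) = b := by
    rw [rho, sum_inner, Finset.sum_eq_single_of_mem b (Finset.mem_Icc.2 ⟨hb, hbn⟩)]
    · rw [real_inner_smul_left, inner_eps_eps (by omega) (by omega), if_pos rfl, mul_one]
    · intro c hc hcb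
      rw [Finset.mem_Icc] at hc
      simp [real_inner_smul_left, inner_eps n c b hc.1 hc.2 hb hbn, hcb]
  rcases lt_trichotomy a 0 with h | rfl | h
  · have := inner_rho_of_pos (b := -a) (by omega) (by omega)
    rwa [eps_neg, inner_neg_right, Int.cast_neg, neg_inj] at this
  · simp [eps_zero]
  · exact inner_rho_of_pos (by omega) (by omega)

/-- The positive multiple of `ε_i` that is a root: the length of the short roots of type `B_n` and
of the long roots of type `C_n`. -/
noncomputable def axisScale : Kind → ℝ
  | .B => 1
  | .C => 2

theorem axisScale_pos (t : Kind) : 0 < axisScale t := by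
  cases t <;> norm_num [axisScale]

/-- The root proportional to `ε_b - ε_a`. As `ε_0 = 0`, the multiples of a single `ε_i` are
included: they are the cases `a = 0` and `b = 0`. -/
noncomputable def diffRoot (t : Kind) (n : ℕ) (a b : ℤ) : E n :=
  (if a = 0 ∨ b = 0 then axisScale t else 1) • (eps n b - eps n a)

theorem exists_diffRoot_eq_smul (t : Kind) (n : ℕ) (a b : ℤ) :
    ∃ c > (0 : ℝ), diffRoot t n a b = c • (eps n b - eps n a) :=
  ⟨_, by split_ifs <;> [exact axisScale_pos t; exact one_pos], rfl⟩

theorem diffRoot_neg_neg (t : Kind) (n : ℕ) (a b : ℤ) :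
    diffRoot t n (-b) (-a) = diffRoot t n a b := by
  simp only [diffRoot, eps_neg, neg_eq_zero, or_comm (a := b = 0)]
  congr 1
  abel

theorem isPosRoot_iff {β : E n} : IsPosRoot t n β ↔
    ∃ a b : ℤ, a.natAbs ≤ n ∧ b.natAbs ≤ n ∧ a < b ∧ a ≠ -b ∧ β = diffRoot t n a b := by
  constructor
  · rintro (⟨i, h1, hn, rfl⟩ | ⟨i, j, h1, hij, hn, rfl | rfl⟩)
    · refine ⟨0, i, by simp, by omega, by omega, by omega, ?_⟩
      cases t <;> simp [diffRoot, axisScale, eps_zero]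
    · exact ⟨i, j, by omega, by omega, hij, by omega,
        by rw [diffRoot, if_neg (by omega), one_smul]⟩
    · exact ⟨-i, j, by omega, by omega, by omega, by omega,
        by rw [diffRoot, if_neg (by omega), one_smul, eps_neg, sub_neg_eq_add]⟩
  · rintro ⟨a, b, ha, hb, hab, hne, rfl⟩
    -- replacing `(a, b)` by `(-b, -a)` if necessary, we may assume `|a| < b`
    wlog hpos : 0 < a + b generalizing a b
    · rw [← diffRoot_neg_neg]
      exact this (-b) (-a) (by omega) (by omega) (by omega) (by omega) (by omega)
    rcases lt_trichotomy a 0 with h | rfl | h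
    · refine .inr ⟨-a, b, by omega, by omega, by omega, .inr ?_⟩
      rw [diffRoot, if_neg (by omega), one_smul, eps_neg, sub_eq_add_neg]
    · refine .inl ⟨b, by omega, by omega, ?_⟩
      cases t <;> simp [diffRoot, axisScale, eps_zero]
    · refine .inr ⟨a, b, by omega, by omega, by omega, .inl ?_⟩
      rw [diffRoot, if_neg (by omega), one_smul]

theorem IsPosRoot.inner_rho_pos {β : E n} (h : IsPosRoot t n β) : 0 < inner ℝ (rho n) β := by
  obtain ⟨a, b, ha, hb, hab, -, rfl⟩ := isPosRoot_iff.1 h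
  obtain ⟨c, hc, hroot⟩ := exists_diffRoot_eq_smul t n a b
  rw [hroot, real_inner_smul_right, inner_sub_right, inner_rho_eps ha, inner_rho_eps hb]
  exact mul_pos hc (sub_pos.2 (mod_cast hab))

theorem IsPosRoot.inner_tailVec_nonneg {β : E n} (h : IsPosRoot t n β) {j : ℤ} (hj : 1 ≤ j) :
    0 ≤ inner ℝ (tailVec n j) β := by
  obtain ⟨a, b, ha, hb, hab, -, rfl⟩ := isPosRoot_iff.1 h
  obtain ⟨c, hc, hroot⟩ := exists_diffRoot_eq_smul t n a b
  rw [hroot, real_inner_smul_right, inner_sub_right, inner_tailVec_eps hj ha,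
    inner_tailVec_eps hj hb]
  refine mul_nonneg hc.le ?_
  split_ifs <;> first | omega | norm_num

theorem simpleRoot_eq_diffRoot (t : Kind) (n : ℕ) (i : ℤ) (hi : 1 ≤ i) :
    simpleRoot t n i = diffRoot t n (i - 1) i := by
  by_cases h : i = 1
  · subst h
    cases t <;> simp [simpleRoot, diffRoot, axisScale, eps_zero]
  · rw [simpleRoot.eq_def, if_neg h, diffRoot, if_neg (by omega), one_smul]

theorem isPosRoot_simpleRoot (t : Kind) {i : ℤ} (hi : 1 ≤ i) (hin : i ≤ n) :
    IsPosRoot t n (simpleRoot t n i) :=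
  isPosRoot_iff.2
    ⟨i - 1, i, by omega, by omega, by omega, by omega, simpleRoot_eq_diffRoot t n i hi⟩

/-- The ratio of `α_i` to `ε_i - ε_{i-1}`, where `ε_0 = 0`. -/
noncomputable def rootScale (t : Kind) (i : ℤ) : ℝ := if i = 1 then axisScale t else 1

theorem rootScale_pos (t : Kind) (i : ℤ) : 0 < rootScale t i := by
  unfold rootScale
  split_ifs
  exacts [axisScale_pos t, one_pos]

theorem simpleRoot_eq_smul (t : Kind) (n : ℕ) (i : ℤ) :
    simpleRoot t n i = rootScale t i • (eps n i - eps n (i - 1)) := by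
  by_cases h : i = 1
  · subst h
    cases t <;> simp [simpleRoot, rootScale, axisScale, eps_zero]
  · rw [simpleRoot.eq_def, if_neg h, rootScale, if_neg h, one_smul]

/-! ### Reflections and signed permutations -/

theorem refl_inv (α : E n) : (refl α)⁻¹ = refl α := Submodule.reflection_inv

theorem refl_refl (α x : E n) : refl α (refl α x) = x := Submodule.reflection_reflection _ _

theorem inner_refl_left (α x y : E n) : inner ℝ (refl α x) y = inner ℝ x (refl α y) := by
  rw [← (refl α).inner_map_map (refl α x), refl_refl]

theorem refl_mul_self (α : E n) : refl α * refl α = 1 := Submodule.reflection_mul_reflection _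

theorem refl_self (α : E n) : refl α α = -α :=
  Submodule.reflection_orthogonalComplement_singleton_eq_neg α

theorem refl_of_inner_eq_zero {α x : E n} (h : inner ℝ x α = 0) : refl α x = x := by
  simp [refl_apply, corootPairing, h]

theorem refl_smul (α : E n) {c : ℝ} (hc : c ≠ 0) : refl (c • α) = refl α := by
  simp only [refl, Submodule.span_singleton_smul_eq (IsUnit.mk0 c hc) α]

theorem refl_map (g : E n ≃ₗᵢ[ℝ] E n) (α : E n) : refl (g α) = g * refl α * g⁻¹ := by
  ext1 x
  obtain ⟨y, rfl⟩ := g.surjective x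
  have hy : g⁻¹ (g y) = y := g.symm_apply_apply y
  simp only [LinearIsometryEquiv.coe_mul, Function.comp_apply, hy, refl_apply, corootPairing,
    LinearIsometryEquiv.inner_map_map, map_sub, map_smul]

theorem norm_eps {a : ℤ} (ha : a ≠ 0) (han : a.natAbs ≤ n) : ‖eps n a‖ = 1 := by
  wlog hpos : 0 < a generalizing a
  · rw [← norm_neg, ← eps_neg]
    exact this (by omega) (by omega) (by omega)
  obtain ⟨j, rfl⟩ := exists_fin_add_one_eq (n := n) (a := a) (by omega) (by omega)
  rw [eps_succ, PiLp.norm_single, norm_one]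

/-- The action of the simple reflection `s_i` on the indices of the vectors `ε_a`: it exchanges `i`
and `j`, as well as `-i` and `-j`, where `j = -1` for `i = 1`. -/
def signedSwap (i a : ℤ) : ℤ :=
  let j := if i = 1 then -1 else i - 1
  if a = i then j else if a = j then i else if a = -i then -j else if a = -j then -i else a

theorem simpleRoot_eq_smul_sub (t : Kind) (n : ℕ) (i : ℤ) :
    ∃ c : ℝ, c ≠ 0 ∧ simpleRoot t n i = c • (eps n i - eps n (if i = 1 then -1 else i - 1)) := by
  by_cases h : i = 1
  · subst h
    cases t
    · exact ⟨1 / 2, by norm_num, by simp only [simpleRoot, if_true, eps_neg]; module⟩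
    · exact ⟨1, by norm_num, by simp only [simpleRoot, if_true, eps_neg]; module⟩
  · exact ⟨1, one_ne_zero, by rw [simpleRoot.eq_def, if_neg h, if_neg h, one_smul]⟩

theorem refl_simpleRoot_eps (t : Kind) {i : ℤ} (hi : 1 ≤ i) (hin : i ≤ n) (a : ℤ) :
    refl (simpleRoot t n i) (eps n a) = eps n (signedSwap i a) := by
  obtain ⟨c, hc, hroot⟩ := simpleRoot_eq_smul_sub t n i
  obtain ⟨j, hj⟩ : ∃ j, j = if i = 1 then -1 else i - 1 := ⟨_, rfl⟩
  rw [hroot, refl_smul _ hc, signedSwap, ← hj]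
  have hj0 : j ≠ 0 ∧ j.natAbs ≤ n := by split_ifs at hj <;> omega
  have refl_i : refl (eps n i - eps n j) (eps n i) = eps n j :=
    Submodule.reflection_sub (by rw [norm_eps (by omega) (by omega), norm_eps hj0.1 hj0.2])
  have refl_j : refl (eps n i - eps n j) (eps n j) = eps n i := by
    nth_rw 2 [← refl_i]
    exact refl_refl _ _
  split_ifs with h1 h2 h3 h4
  · rw [h1, refl_i]
  · rw [h2, refl_j]
  · rw [h3, eps_neg, eps_neg, map_neg, refl_i]
  · rw [h4, eps_neg, eps_neg, map_neg, refl_j]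
  · refine refl_of_inner_eq_zero ?_
    have inner_eq_zero {b : ℤ} (hb : 1 ≤ b) (hbn : b ≤ n) (h : a ≠ b) (h' : a ≠ -b) :
        inner ℝ (eps n a) (eps n b) = 0 := by
      rw [inner_eps_eps (by omega) (by omega), if_neg h, if_neg h']
    rw [inner_sub_right, inner_eq_zero hi hin h1 h3]
    split_ifs at hj with hi1
    · rw [hj, eps_neg, inner_neg_right, inner_eq_zero le_rfl (by omega) (by omega) (by omega),
        neg_zero, sub_zero]
    · rw [inner_eq_zero (by omega) (by omega) h2 h4, sub_zero]

theorem signedSwap_signedSwap {i : ℤ} (hi : 1 ≤ i) (a : ℤ) : signedSwap i (signedSwap i a) = a := by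
  grind [signedSwap]

theorem signedSwap_neg {i : ℤ} (hi : 1 ≤ i) (a : ℤ) : signedSwap i (-a) = -signedSwap i a := by
  grind [signedSwap]

theorem natAbs_signedSwap_le {i a : ℤ} (hi : 1 ≤ i) (hin : i ≤ n) (ha : a.natAbs ≤ n) :
    (signedSwap i a).natAbs ≤ n := by
  simp only [signedSwap]
  split_ifs <;> omega

theorem signedSwap_eq_zero_iff {i a : ℤ} (hi : 1 ≤ i) : signedSwap i a = 0 ↔ a = 0 := by
  grind [signedSwap]

theorem signedSwap_lt {i a b : ℤ} (hi : 1 ≤ i) (hab : a < b) (hne : a ≠ -b)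
    (h : ¬ (a = i - 1 ∧ b = i)) (h' : ¬ (a = -i ∧ b = 1 - i)) :
    signedSwap i a < signedSwap i b := by
  simp only [signedSwap]
  split_ifs <;> omega

theorem refl_simpleRoot_diffRoot (t : Kind) {i : ℤ} (hi : 1 ≤ i) (hin : i ≤ n) (a b : ℤ) :
    refl (simpleRoot t n i) (diffRoot t n a b) =
      diffRoot t n (signedSwap i a) (signedSwap i b) := by
  simp only [diffRoot, map_smul, map_sub, refl_simpleRoot_eps t hi hin, signedSwap_eq_zero_iff hi]

theorem IsPosRoot.refl_simpleRoot {β : E n} (h : IsPosRoot t n β) {i : ℤ}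
    (hi : 1 ≤ i) (hin : i ≤ n) (hne : β ≠ simpleRoot t n i) :
    IsPosRoot t n (refl (simpleRoot t n i) β) := by
  obtain ⟨a, b, ha, hb, hab, hab', rfl⟩ := isPosRoot_iff.1 h
  rw [simpleRoot_eq_diffRoot t n i hi] at hne
  refine isPosRoot_iff.2 ⟨_, _, natAbs_signedSwap_le hi hin ha, natAbs_signedSwap_le hi hin hb,
    signedSwap_lt hi hab hab' ?_ ?_, ?_, refl_simpleRoot_diffRoot t hi hin a b⟩
  · rintro ⟨rfl, rfl⟩
    exact hne rfl
  · rintro ⟨rfl, rfl⟩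
    exact hne (by rw [← diffRoot_neg_neg, neg_neg, neg_sub])
  · rw [← signedSwap_neg hi]
    exact (Function.LeftInverse.injective (signedSwap_signedSwap hi)).ne hab'

theorem weylGroup_induction {p : (E n ≃ₗᵢ[ℝ] E n) → Prop} (one : p 1)
    (refl_mul : ∀ i : ℤ, 1 ≤ i → i ≤ n → ∀ g, p g → p (refl (simpleRoot t n i) * g))
    {g : E n ≃ₗᵢ[ℝ] E n} (hg : g ∈ weylGroup t n) : p g := by
  induction hg using Subgroup.closure_induction_left with
  | one => exact one
  | mul_left s hs g _ hg =>
    obtain ⟨i, hi, hin, rfl⟩ := hs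
    exact refl_mul i hi hin g hg
  | inv_mul_cancel s hs g _ hg =>
    obtain ⟨i, hi, hin, rfl⟩ := hs
    rw [refl_inv]
    exact refl_mul i hi hin g hg

/-- Permutations of the indices `a` of the vectors `ε_a` that arise from Weyl group elements; only
their values on `[-n, n]` matter. -/
structure IsSignedPerm (n : ℕ) (σ : Equiv.Perm ℤ) : Prop where
  map_neg (a : ℤ) : σ (-a) = -σ a
  natAbs_le_iff (a : ℤ) : (σ a).natAbs ≤ n ↔ a.natAbs ≤ n

theorem exists_isSignedPerm (w : weylGroup t n) :
    ∃ σ : Equiv.Perm ℤ, IsSignedPerm n σ ∧ ∀ a, w.1 (eps n a) = eps n (σ a) := by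
  refine weylGroup_induction (p := fun g => ∃ σ : Equiv.Perm ℤ, IsSignedPerm n σ ∧
    ∀ a, g (eps n a) = eps n (σ a)) ⟨1, ⟨fun _ => rfl, fun _ => Iff.rfl⟩, fun _ => rfl⟩ ?_ w.2
  rintro i hi hin g ⟨σ, hσ, hg⟩
  have hinv : Function.Involutive (signedSwap i) := signedSwap_signedSwap hi
  refine ⟨hinv.toPerm * σ, ⟨fun a => ?_, fun a => ?_⟩, fun a => ?_⟩
  · simp [hσ.map_neg, signedSwap_neg hi]
  · rw [← hσ.natAbs_le_iff a]
    refine ⟨fun h => ?_, natAbs_signedSwap_le hi hin⟩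
    simpa [hinv (σ a)] using natAbs_signedSwap_le hi hin h
  · simp [hg, refl_simpleRoot_eps t hi hin]

/-! ### Coxeter length and Bruhat order -/

/-- The product of the simple reflections with the indices in a list. -/
noncomputable def wordProd (t : Kind) (n : ℕ) (l : List ℤ) : E n ≃ₗᵢ[ℝ] E n :=
  (l.map fun i => refl (simpleRoot t n i)).prod

theorem wordProd_cons (t : Kind) (n : ℕ) (i : ℤ) (l : List ℤ) :
    wordProd t n (i :: l) = refl (simpleRoot t n i) * wordProd t n l := by
  simp only [wordProd, List.map_cons, List.prod_cons]

theorem exists_reduced_word (w : weylGroup t n) :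
    ∃ l : List ℤ, l.length = coxeterLength w ∧ (∀ i ∈ l, 1 ≤ i ∧ i ≤ n) ∧ w.1 = wordProd t n l := by
  have exists_word : ∃ l : List ℤ, (∀ i ∈ l, 1 ≤ i ∧ i ≤ n) ∧ w.1 = wordProd t n l := by
    refine weylGroup_induction (p := fun g => ∃ l : List ℤ, (∀ i ∈ l, 1 ≤ i ∧ i ≤ n) ∧
      g = wordProd t n l) ⟨[], by simp, rfl⟩ ?_ w.2
    rintro i hi hin g ⟨l, hl, rfl⟩
    exact ⟨i :: l, List.forall_mem_cons.2 ⟨⟨hi, hin⟩, hl⟩, (wordProd_cons t n i l).symm⟩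
  obtain ⟨l, hl, hw⟩ := exists_word
  exact Nat.sInf_mem (s := {k | ∃ l : List ℤ, l.length = k ∧ (∀ i ∈ l, 1 ≤ i ∧ i ≤ n) ∧
    w.1 = wordProd t n l}) ⟨l.length, l, rfl, hl, hw⟩

theorem coxeterLength_le (w : weylGroup t n) {l : List ℤ}
    (hl : ∀ i ∈ l, 1 ≤ i ∧ i ≤ n) (h : w.1 = wordProd t n l) : coxeterLength w ≤ l.length :=
  Nat.sInf_le ⟨l, rfl, hl, h⟩

theorem exists_word_refl_mul {l : List ℤ} (hl : ∀ i ∈ l, 1 ≤ i ∧ i ≤ n) {β : E n}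
    (hβ : IsPosRoot t n β) (hneg : ¬ IsPosRoot t n ((wordProd t n l)⁻¹ β)) :
    ∃ l' : List ℤ, l'.length < l.length ∧ (∀ i ∈ l', 1 ≤ i ∧ i ≤ n) ∧
      refl β * wordProd t n l = wordProd t n l' := by
  induction l generalizing β with
  | nil => exact absurd hβ (by simpa [wordProd] using hneg)
  | cons i l ih =>
    obtain ⟨⟨hi, hin⟩, hl⟩ := List.forall_mem_cons.1 hl
    by_cases hβi : β = simpleRoot t n i
    · refine ⟨l, Nat.lt_succ_self _, hl, ?_⟩
      rw [hβi, wordProd_cons, ← mul_assoc, refl_mul_self, one_mul]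
    · rw [wordProd_cons, mul_inv_rev, refl_inv] at hneg
      obtain ⟨l', hlen, hl', hprod⟩ := ih hl (hβ.refl_simpleRoot hi hin hβi) hneg
      refine ⟨i :: l', Nat.succ_lt_succ hlen, List.forall_mem_cons.2 ⟨⟨hi, hin⟩, hl'⟩, ?_⟩
      rw [wordProd_cons, wordProd_cons, ← hprod, refl_map, refl_inv]
      simp only [← mul_assoc, refl_mul_self, one_mul]

theorem coxeterLength_lt_of_eq_refl_mul {u w : weylGroup t n} {β : E n} (hβ : IsPosRoot t n β)
    (hneg : ¬ IsPosRoot t n (u.1⁻¹ β)) (hw : w.1 = refl β * u.1) :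
    coxeterLength w < coxeterLength u := by
  obtain ⟨l, hlen, hl, hu⟩ := exists_reduced_word u
  rw [hu] at hneg hw
  obtain ⟨l', hlt, hl', hprod⟩ := exists_word_refl_mul hl hβ hneg
  exact (coxeterLength_le w hl' (hw.trans hprod)).trans_lt (hlt.trans_eq hlen)

theorem inner_apply_left (g : E n ≃ₗᵢ[ℝ] E n) (x y : E n) :
    inner ℝ (g x) y = inner ℝ x (g⁻¹ y) := by
  rw [← g.inner_map_map x]
  exact congrArg _ (g.apply_symm_apply y).symm

theorem not_isPosRoot_inv_apply {g : E n ≃ₗᵢ[ℝ] E n} {r : ℤ} (hr : 1 ≤ r) {β : E n}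
    (h : inner ℝ (g (tailVec n r)) β < 0) : ¬ IsPosRoot t n (g⁻¹ β) := fun hpos => by
  rw [inner_apply_left] at h
  exact h.not_ge (hpos.inner_tailVec_nonneg hr)

/-- The simple reflection `s_i` as an element of the Weyl group. -/
noncomputable def simpleRefl (t : Kind) {n : ℕ} {i : ℤ} (hi : 1 ≤ i) (hin : i ≤ n) :
    weylGroup t n :=
  ⟨refl (simpleRoot t n i), Subgroup.subset_closure ⟨i, hi, hin, rfl⟩⟩

theorem inner_refl_self (x α : E n) : inner ℝ (refl α x) α = -inner ℝ x α := by
  rw [inner_refl_left, refl_self, inner_neg_right]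

theorem BruhatLE.simpleRefl_mul {r : ℤ} (hr : 1 ≤ r) {v : weylGroup t n} {i : ℤ}
    (hi : 1 ≤ i) (hin : i ≤ n) (hpos : 0 < inner ℝ (v.1 (tailVec n r)) (simpleRoot t n i)) :
    BruhatLE v (simpleRefl t hi hin * v) := by
  have hroot := isPosRoot_simpleRoot t hi hin
  refine .single ⟨simpleRoot t n i, hroot, rfl, coxeterLength_lt_of_eq_refl_mul hroot ?_ ?_⟩
  · refine not_isPosRoot_inv_apply hr ?_
    rw [← neg_pos, ← inner_refl_self]
    exact hpos.trans_eq (congrArg (inner ℝ · _) (refl_refl _ _).symm)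
  · exact (by rw [← mul_assoc, refl_mul_self, one_mul] :
      v.1 = refl (simpleRoot t n i) * (refl (simpleRoot t n i) * v.1))

theorem BruhatStep.inner_le {r : ℤ} (hr : 1 ≤ r) {u w : weylGroup t n} (h : BruhatStep u w)
    {j : ℤ} (hj : 1 ≤ j) : inner ℝ (w.1 (tailVec n r)) (tailVec n j) ≤
      inner ℝ (u.1 (tailVec n r)) (tailVec n j) := by
  obtain ⟨β, hβ, hw, hlt⟩ := h
  have hu : 0 ≤ inner ℝ (u.1 (tailVec n r)) β := not_lt.1 fun hneg =>
    hlt.not_gt (coxeterLength_lt_of_eq_refl_mul hβ (not_isPosRoot_inv_apply hr hneg) hw)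
  have hpairing : 0 ≤ corootPairing (u.1 (tailVec n r)) β :=
    div_nonneg (mul_nonneg zero_le_two hu) real_inner_self_nonneg
  rw [hw, LinearIsometryEquiv.coe_mul, Function.comp_apply, refl_apply, inner_sub_left,
    real_inner_smul_left, real_inner_comm _ β]
  exact sub_le_self _ (mul_nonneg hpairing (hβ.inner_tailVec_nonneg hj))

theorem BruhatLE.inner_le {r : ℤ} (hr : 1 ≤ r) {u w : weylGroup t n} (h : BruhatLE u w)
    {j : ℤ} (hj : 1 ≤ j) : inner ℝ (w.1 (tailVec n r)) (tailVec n j) ≤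
      inner ℝ (u.1 (tailVec n r)) (tailVec n j) := by
  induction h with
  | refl => exact le_rfl
  | tail _ hstep ih => exact (hstep.inner_le hr hj).trans ih

/-! ### Minimal representatives -/

theorem corootPairing_tailVec {i j : ℤ} (hi : 1 ≤ i) (hin : i ≤ n) (hj : 1 ≤ j) (hjn : j ≤ n) :
    corootPairing (tailVec n j) (simpleRoot .C n i) = if j = i then 1 else 0 :=
  corootPairing_fundWeight .C n j i hj hjn hi hin

theorem refl_simpleRoot_tailVec (t : Kind) {i j : ℤ} (hi : 1 ≤ i) (hin : i ≤ n) (hj : 1 ≤ j)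
    (hjn : j ≤ n) : refl (simpleRoot t n i) (tailVec n j) =
      tailVec n j - (if j = i then 1 else 0 : ℝ) • simpleRoot .C n i := by
  rw [simpleRoot_eq_smul t, refl_smul _ (rootScale_pos t i).ne',
    ← refl_smul _ (rootScale_pos .C i).ne', ← simpleRoot_eq_smul, refl_apply,
    corootPairing_tailVec hi hin hj hjn]

theorem inner_tailVec_eps_sub {r j : ℤ} (hr : 1 ≤ r) (hj : 1 ≤ j) (hjn : j ≤ n) :
    inner ℝ (tailVec n r) (eps n j - eps n (j - 1)) = if r = j then (1 : ℝ) else 0 := by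
  rw [inner_sub_right, inner_tailVec_eps hr (by omega), inner_tailVec_eps hr (by omega)]
  split_ifs <;> first | omega | norm_num

theorem simpleRefl_mul_mem_minReps {r : ℤ} (hr : 1 ≤ r) {v : weylGroup t n}
    (hv : v ∈ minReps t n r) {i : ℤ} (hi : 1 ≤ i) (hin : i ≤ n)
    (hne : inner ℝ (v.1 (tailVec n r)) (simpleRoot t n i) ≠ 0) :
    simpleRefl t hi hin * v ∈ minReps t n r := by
  intro j hj hjn hjr
  change IsPosRoot t n (refl (simpleRoot t n i) (v.1 (simpleRoot t n j)))
  refine (hv j hj hjn hjr).refl_simpleRoot hi hin fun h => hne ?_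
  rw [← h, LinearIsometryEquiv.inner_map_map, simpleRoot_eq_smul, real_inner_smul_right,
    inner_tailVec_eps_sub hr hj hjn, if_neg hjr.symm, mul_zero]

theorem apply_epsSum {g : E n ≃ₗᵢ[ℝ] E n} {σ : Equiv.Perm ℤ} (hg : ∀ a, g (eps n a) = eps n (σ a))
    (P : Finset ℤ) : g (epsSum n P) = epsSum n (P.map σ.toEmbedding) := by
  simp only [epsSum, map_sum, Finset.sum_map, hg, Equiv.coe_toEmbedding]

theorem IsSignedSet.map {P : Finset ℤ} (hP : IsSignedSet n P) {σ : Equiv.Perm ℤ}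
    (hσ : IsSignedPerm n σ) : IsSignedSet n (P.map σ.toEmbedding) := by
  intro a ha
  obtain ⟨b, hb, rfl⟩ := Finset.mem_map.1 ha
  rw [Equiv.coe_toEmbedding, hσ.natAbs_le_iff, ← hσ.map_neg, ← Equiv.coe_toEmbedding,
    Finset.mem_map']
  exact hP b hb

theorem exists_apply_tailVec_eq_epsSum {r : ℤ} (hr : 1 ≤ r) (hrn : r ≤ n) (w : weylGroup t n) :
    ∃ P, IsSignedSet n P ∧ r + P.card = n + 1 ∧ w.1 (tailVec n r) = epsSum n P := by
  obtain ⟨σ, hσ, hw⟩ := exists_isSignedPerm w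
  refine ⟨_, (isSignedSet_Icc hr).map hσ, ?_, apply_epsSum hw _⟩
  rw [Finset.card_map, Int.card_Icc]
  omega

theorem IsSignedSet.add_one_mem {P : Finset ℤ} (hP : IsSignedSet n P)
    (hdom : ∀ i : ℤ, 1 ≤ i → i ≤ n → 0 ≤ inner ℝ (epsSum n P) (eps n i - eps n (i - 1)))
    {a : ℤ} (ha : a ∈ P) (han : a + 1 ≤ n) : a + 1 ∈ P := by
  have hstep : 0 ≤ inner ℝ (epsSum n P) (eps n (a + 1) - eps n a) := by
    rcases lt_or_ge a 0 with h | h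
    · have := hdom (-a) (by omega) (by have := (hP a ha).1; omega)
      rwa [eps_neg, show -a - 1 = -(a + 1) by ring, eps_neg, neg_sub_neg] at this
    · simpa using hdom (a + 1) (by omega) han
  rw [hP.mem_iff] at ha ⊢
  rw [inner_sub_right] at hstep
  linarith

theorem IsSignedSet.eq_Icc_of_dominant {P : Finset ℤ} (hP : IsSignedSet n P)
    (hdom : ∀ i : ℤ, 1 ≤ i → i ≤ n → 0 ≤ inner ℝ (epsSum n P) (eps n i - eps n (i - 1)))
    {r : ℤ} (hcard : r + P.card = n + 1) : P = Finset.Icc r (n : ℤ) := by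
  have Icc_subset {a : ℤ} (ha : a ∈ P) : Finset.Icc a (n : ℤ) ⊆ P := fun b hb => by
    rw [Finset.mem_Icc] at hb
    obtain ⟨hab, hbn⟩ := hb
    induction b, hab using Int.leInduction with
    | base => exact ha
    | succ b _ ih => exact hP.add_one_mem hdom (ih (by omega)) hbn
  refine Finset.eq_of_subset_of_card_le (fun a ha => ?_) (by rw [Int.card_Icc]; omega)
  obtain ⟨han, hneg⟩ := hP a ha
  have hpos : 0 < a := by
    by_contra h
    exact hneg (Icc_subset ha (Finset.mem_Icc.2 (by omega)))
  have hle := Finset.card_le_card (Icc_subset ha)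
  rw [Int.card_Icc] at hle
  exact Finset.mem_Icc.2 (by omega)

theorem IsPosRoot.inner_rho_lt_refl {α : E n} (hα : IsPosRoot t n α) {x : E n}
    (hx : inner ℝ x α < 0) : inner ℝ x (rho n) < inner ℝ (refl α x) (rho n) := by
  have hself : 0 < inner ℝ α α := by
    refine real_inner_self_pos.2 fun h => ?_
    rw [h, inner_zero_right] at hx
    exact hx.false
  have hpairing : corootPairing x α < 0 := div_neg_of_neg_of_pos (by linarith) hself
  rw [refl_apply, inner_sub_left, real_inner_smul_left, real_inner_comm (rho n) α]
  linarith [mul_neg_of_neg_of_pos hpairing hα.inner_rho_pos]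

theorem IsSignedSet.induction_rho {p : Finset ℤ → Prop}
    (step : ∀ P, IsSignedSet n P → (∀ Q, IsSignedSet n Q →
      inner ℝ (epsSum n P) (rho n) < inner ℝ (epsSum n Q) (rho n) → p Q) → p P)
    {P : Finset ℤ} (hP : IsSignedSet n P) : p P := by
  classical
  by_contra hp
  let counterexamples := (Finset.Icc (-n : ℤ) n).powerset.filter fun P => IsSignedSet n P ∧ ¬ p P
  have mem_counterexamples {Q : Finset ℤ} (hQ : IsSignedSet n Q) (h : ¬ p Q) :
      Q ∈ counterexamples :=
    Finset.mem_filter.2 ⟨Finset.mem_powerset.2 fun a ha => Finset.mem_Icc.2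
      (by have := (hQ a ha).1; omega), hQ, h⟩
  obtain ⟨Q, hQ, hmax⟩ := counterexamples.exists_max_image (fun P => inner ℝ (epsSum n P) (rho n))
    ⟨P, mem_counterexamples hP hp⟩
  obtain ⟨hQ, hq⟩ := (Finset.mem_filter.1 hQ).2
  refine hq (step Q hQ fun Q' hQ' hlt => ?_)
  by_contra h
  exact hlt.not_ge (hmax Q' (mem_counterexamples hQ' h))

theorem IsSignedSet.exists_refl_simpleRoot_eq (t : Kind) {P : Finset ℤ} (hP : IsSignedSet n P)
    {i : ℤ} (hi : 1 ≤ i) (hin : i ≤ n) : ∃ Q : Finset ℤ, IsSignedSet n Q ∧ Q.card = P.card ∧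
      refl (simpleRoot t n i) (epsSum n P) = epsSum n Q := by
  obtain ⟨σ, hσ, hs⟩ := exists_isSignedPerm (simpleRefl t hi hin)
  exact ⟨_, hP.map hσ, Finset.card_map _, apply_epsSum hs P⟩

theorem exists_mem_minReps_apply_tailVec_eq (t : Kind) {r : ℤ} (hr : 1 ≤ r) {P : Finset ℤ}
    (hP : IsSignedSet n P) (hcard : r + P.card = n + 1) :
    ∃ v ∈ minReps t n r, v.1 (tailVec n r) = epsSum n P := by
  refine hP.induction_rho (p := fun P => r + P.card = n + 1 → ∃ v ∈ minReps t n r,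
    v.1 (tailVec n r) = epsSum n P) (fun P hP ih hcard => ?_) hcard
  -- Unless the vector is dominant, a simple reflection increases its pairing with `ρ`.
  by_cases hdom : ∀ i : ℤ, 1 ≤ i → i ≤ n → 0 ≤ inner ℝ (epsSum n P) (eps n i - eps n (i - 1))
  · refine ⟨1, fun j hj hjn _ => isPosRoot_simpleRoot t hj hjn, ?_⟩
    rw [hP.eq_Icc_of_dominant hdom hcard]
    rfl
  push Not at hdom
  obtain ⟨i, hi, hin, hneg⟩ := hdom
  have hα : inner ℝ (epsSum n P) (simpleRoot t n i) < 0 := by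
    rw [simpleRoot_eq_smul, real_inner_smul_right]
    exact mul_neg_of_pos_of_neg (rootScale_pos t i) hneg
  obtain ⟨Q, hQ, hQcard, hPQ⟩ := hP.exists_refl_simpleRoot_eq t hi hin
  obtain ⟨v, hv, hvQ⟩ := ih Q hQ
    (hPQ ▸ (isPosRoot_simpleRoot t hi hin).inner_rho_lt_refl hα) (by rw [hQcard, hcard])
  rw [← hPQ] at hvQ
  refine ⟨_, simpleRefl_mul_mem_minReps hr hv hi hin ?_, ?_⟩
  · rw [hvQ, inner_refl_self]
    exact neg_ne_zero.2 hα.ne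
  · exact (congrArg _ hvQ).trans (refl_refl _ _)

theorem inner_sum_smul_simpleRoot (t : Kind) (c : ℤ → ℝ) {j : ℤ} (hj : 1 ≤ j) (hjn : j ≤ n) :
    inner ℝ (∑ i ∈ Finset.Icc (1 : ℤ) n, c i • simpleRoot t n i) (tailVec n j) =
      c j * rootScale t j := by
  rw [sum_inner, Finset.sum_eq_single_of_mem j (Finset.mem_Icc.2 ⟨hj, hjn⟩)]
  · rw [simpleRoot_eq_smul, real_inner_smul_left, real_inner_smul_left, real_inner_comm,
      inner_tailVec_eps_sub hj hj hjn, if_pos rfl, mul_one]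
  · intro i hi hij
    rw [Finset.mem_Icc] at hi
    rw [simpleRoot_eq_smul, real_inner_smul_left, real_inner_smul_left, real_inner_comm,
      inner_tailVec_eps_sub hj hi.1 hi.2, if_neg hij.symm, mul_zero, mul_zero]

theorem nonnegWeight_iff {x : E n} : NonnegWeight t n x ↔
    ∀ j : ℤ, 1 ≤ j → j ≤ n → 0 ≤ inner ℝ x (tailVec n j) := by
  constructor
  · rintro ⟨c, hc, rfl⟩ j hj hjn
    rw [inner_sum_smul_simpleRoot t c hj hjn]
    exact mul_nonneg (hc j) (rootScale_pos t j).le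
  · intro h
    refine ⟨fun j => if 1 ≤ j ∧ j ≤ n then inner ℝ x (tailVec n j) / rootScale t j else 0,
      fun j => ?_, ext_inner_tailVec fun j hj => ?_⟩
    · dsimp only
      split_ifs with hj
      exacts [div_nonneg (h j hj.1 hj.2) (rootScale_pos t j).le, le_rfl]
    · rcases le_or_gt j n with hjn | hjn
      · rw [inner_sum_smul_simpleRoot t _ hj hjn, if_pos ⟨hj, hjn⟩,
          div_mul_cancel₀ _ (rootScale_pos t j).ne']
      · rw [tailVec_of_lt hjn, inner_zero_right, inner_zero_right]

theorem nonnegWeight_apply_fundWeight_iff (g : E n ≃ₗᵢ[ℝ] E n) {r : ℤ} :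
    NonnegWeight t n (g (fundWeight t n r)) ↔
      ∀ j : ℤ, 1 ≤ j → j ≤ n → 0 ≤ inner ℝ (g (tailVec n r)) (tailVec n j) := by
  simp only [nonnegWeight_iff, fundWeight_eq_smul, map_smul, real_inner_smul_left,
    mul_nonneg_iff_of_pos_left (weightScale_pos t r)]

theorem lt_of_mem_minReps {r : ℤ} {v : weylGroup t n} (hv : v ∈ minReps t n r)
    {σ : Equiv.Perm ℤ} (hσ : IsSignedPerm n σ) (hvσ : ∀ a, v.1 (eps n a) = eps n (σ a))
    {j : ℤ} (hj : 1 ≤ j) (hjn : j ≤ n) (hjr : j ≠ r) : σ (j - 1) < σ j := by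
  have hpos := (hv j hj hjn hjr).inner_rho_pos
  rw [simpleRoot_eq_smul, map_smul, map_sub, hvσ, hvσ, real_inner_smul_right, inner_sub_right,
    inner_rho_eps ((hσ.natAbs_le_iff _).2 (by omega)),
    inner_rho_eps ((hσ.natAbs_le_iff _).2 (by omega)),
    mul_pos_iff_of_pos_left (rootScale_pos t j), sub_pos] at hpos
  exact_mod_cast hpos

theorem strictMonoOn_of_mem_minReps {r : ℤ} {v : weylGroup t n} (hv : v ∈ minReps t n r)
    {σ : Equiv.Perm ℤ} (hσ : IsSignedPerm n σ) (hvσ : ∀ a, v.1 (eps n a) = eps n (σ a))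
    {s : Set ℤ} (hs : s.OrdConnected) (hsn : s ⊆ Set.Icc 0 n) (hsr : ∀ j ∈ s, j - 1 ∈ s → j ≠ r) :
    StrictMonoOn σ s := by
  refine strictMonoOn_of_sub_one_lt hs fun j _ hj hj' => ?_
  have := (hsn hj').1
  exact lt_of_mem_minReps hv hσ hvσ (by omega) (hsn hj).2 (hsr j hj hj')

theorem eq_map_range_of_sortedLT {l : List ℤ} (hl : l.SortedLT) {f : ℤ → ℤ} {a : ℤ} {k : ℕ}
    (hf : StrictMonoOn f (Set.Ico a (a + k)))
    (hmem : ∀ b, b ∈ l ↔ ∃ j, a ≤ j ∧ j < a + k ∧ f j = b) :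
    l = (List.range k).map fun i : ℕ => f (a + i) := by
  refine hl.eq_of_mem_iff (List.Pairwise.sortedLT ?_) fun b => ?_
  · refine List.pairwise_map.2 <|
      (List.pairwise_lt_range (n := k)).imp_of_mem fun {i j} hi hj hij => ?_
    rw [List.mem_range] at hi hj
    exact hf ⟨by omega, by omega⟩ ⟨by omega, by omega⟩ (by omega)
  · simp only [hmem, List.mem_map, List.mem_range]
    constructor
    · rintro ⟨j, haj, hjk, rfl⟩
      exact ⟨(j - a).toNat, by omega, by congr 1; omega⟩
    · rintro ⟨i, hik, rfl⟩
      exact ⟨a + i, by omega, by omega, rfl⟩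

theorem apply_pos_of_mem_minReps {r : ℤ} (hrn : r ≤ n) {v : weylGroup t n} (hv : v ∈ minReps t n r)
    {σ : Equiv.Perm ℤ} (hσ : IsSignedPerm n σ) (hvσ : ∀ a, v.1 (eps n a) = eps n (σ a))
    {j : ℤ} (hj : 0 < j) (hjr : j < r) : 0 < σ j := by
  have mono : StrictMonoOn σ (Set.Ico 0 r) := strictMonoOn_of_mem_minReps hv hσ hvσ
    Set.ordConnected_Ico (fun j hj => ⟨hj.1, hj.2.le.trans hrn⟩) fun j hj _ => hj.2.ne
  have hlt := mono ⟨le_rfl, hj.trans hjr⟩ ⟨hj.le, hjr⟩ hj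
  have hzero := hσ.map_neg 0
  rw [neg_zero] at hzero
  omega

theorem IsSignedSet.apply_mem_iff {r : ℤ} (hr : 1 ≤ r) {g : E n ≃ₗᵢ[ℝ] E n} {σ : Equiv.Perm ℤ}
    (hσ : IsSignedPerm n σ) (hg : ∀ a, g (eps n a) = eps n (σ a)) {P : Finset ℤ}
    (hP : IsSignedSet n P) (hgP : g (tailVec n r) = epsSum n P) {j : ℤ} :
    σ j ∈ P ↔ r ≤ j ∧ j ≤ n := by
  have hIcc : P = (Finset.Icc r n).map σ.toEmbedding :=
    hP.eq_of_epsSum_eq ((isSignedSet_Icc hr).map hσ) (hgP ▸ apply_epsSum hg _)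
  rw [hIcc, ← Equiv.coe_toEmbedding, Finset.mem_map', Finset.mem_Icc]

theorem IsSignedSet.apply_notMem_iff {r : ℤ} (hr : 1 ≤ r) (hrn : r ≤ n) {v : weylGroup t n}
    (hv : v ∈ minReps t n r) {σ : Equiv.Perm ℤ} (hσ : IsSignedPerm n σ)
    (hvσ : ∀ a, v.1 (eps n a) = eps n (σ a)) {P : Finset ℤ} (hP : IsSignedSet n P)
    (hvP : v.1 (tailVec n r) = epsSum n P) {j : ℤ} :
    (1 ≤ σ j ∧ σ j ≤ n ∧ σ j ∉ P ∧ -σ j ∉ P) ↔ 1 ≤ j ∧ j < r := by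
  rw [← hσ.map_neg, hP.apply_mem_iff hr hσ hvσ hvP, hP.apply_mem_iff hr hσ hvσ hvP]
  have hle := hσ.natAbs_le_iff j
  have hneg := hσ.map_neg j
  have pos {j : ℤ} := apply_pos_of_mem_minReps hrn hv hσ hvσ (j := j)
  rcases lt_trichotomy j 0 with h | rfl | h
  · have := pos (j := -j) (by omega)
    omega
  · rw [neg_zero] at hneg
    omega
  · have := pos h
    omega

theorem isWindow_append {r : ℕ} (hr : 1 ≤ r) (hrn : r ≤ n) {v : weylGroup t n}
    (hv : v ∈ minReps t n r) {P : Finset ℤ} (hP : IsSignedSet n P)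
    (hvP : v.1 (tailVec n r) = epsSum n P) {l l' : List ℤ} (hl : l.SortedLT) (hl' : l'.SortedLT)
    (hmem : ∀ a, a ∈ l ↔ 1 ≤ a ∧ a ≤ n ∧ a ∉ P ∧ -a ∉ P) (hmem' : ∀ a, a ∈ l' ↔ a ∈ P) :
    IsWindow v (l ++ l') := by
  obtain ⟨σ, hσ, hvσ⟩ := exists_isSignedPerm v
  have mono {s : Set ℤ} := strictMonoOn_of_mem_minReps hv hσ hvσ (s := s)
  have hleft : l = (List.range (r - 1)).map fun i : ℕ => σ (1 + i) := by
    refine eq_map_range_of_sortedLT hl (mono Set.ordConnected_Ico (fun j hj => ?_) ?_) fun b => ?_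
    · exact ⟨by have := hj.1; omega, by have := hj.2; omega⟩
    · exact fun j hj _ => by have := hj.2; omega
    obtain ⟨j, rfl⟩ := σ.surjective b
    rw [hmem, hP.apply_notMem_iff (mod_cast hr) (mod_cast hrn) hv hσ hvσ hvP]
    simp only [σ.injective.eq_iff, exists_eq_right_right]
    omega
  have hright : l' = (List.range (n + 1 - r)).map fun i : ℕ => σ (r + i) := by
    refine eq_map_range_of_sortedLT hl' (mono Set.ordConnected_Ico (fun j hj => ?_) ?_) fun b => ?_
    · exact ⟨by have := hj.1; omega, by have := hj.2; omega⟩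
    · exact fun j _ hj => by have := hj.1; omega
    obtain ⟨j, rfl⟩ := σ.surjective b
    simp only [hmem', hP.apply_mem_iff (mod_cast hr) hσ hvσ hvP, σ.injective.eq_iff,
      exists_eq_right_right]
    omega
  rw [hleft, hright]
  refine ⟨by simp only [List.length_append, List.length_map, List.length_range]; omega,
    fun k hk => ?_⟩
  rw [hvσ]
  congr 1
  simp only [List.getElem_append, List.getElem_map, List.getElem_range, List.length_map,
    List.length_range]
  split_ifs <;> congr 1 <;> omega

theorem IsWindow.ext {v w : weylGroup t n} {l : List ℤ} (hv : IsWindow v l) (hw : IsWindow w l) :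
    v = w := by
  refine Subtype.ext (LinearIsometryEquiv.ext fun x => ?_)
  have hbasis : v.1.toLinearEquiv.toLinearMap = w.1.toLinearEquiv.toLinearMap := by
    refine (EuclideanSpace.basisFun (Fin n) ℝ).toBasis.ext fun j => ?_
    simpa [eps_succ] using (hv.2 j (by rw [hv.1]; exact j.2)).trans (hw.2 j _).symm
  exact LinearMap.congr_fun hbasis x

theorem minReps_ext {r : ℕ} (hr : 1 ≤ r) (hrn : r ≤ n) {v w : weylGroup t n}
    (hv : v ∈ minReps t n r) (hw : w ∈ minReps t n r) (h : v.1 (tailVec n r) = w.1 (tailVec n r)) :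
    v = w := by
  obtain ⟨P, hP, -, hvP⟩ := exists_apply_tailVec_eq_epsSum (r := r) (mod_cast hr) (mod_cast hrn) v
  let zeros := (Finset.Icc (1 : ℤ) n).filter fun a => a ∉ P ∧ -a ∉ P
  have isWindow {u : weylGroup t n} (hu : u ∈ minReps t n r)
      (huP : u.1 (tailVec n r) = epsSum n P) : IsWindow u (zeros.sort ++ P.sort) :=
    isWindow_append hr hrn hu hP huP (Finset.sortedLT_sort _) (Finset.sortedLT_sort _)
      (by simp [zeros, and_assoc]) (by simp)
  exact (isWindow hv hvP).ext (isWindow hw (h ▸ hvP))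

theorem inner_refl_tailVec_neg_of_mem_maximalElements {r : ℤ} (hr : 1 ≤ r) {v : weylGroup t n}
    (hv : v ∈ maximalElements t n r) {i : ℤ} (hi : 1 ≤ i) (hin : i ≤ n)
    (hpos : 0 < inner ℝ (v.1 (tailVec n r)) (simpleRoot t n i)) :
    inner ℝ (refl (simpleRoot t n i) (v.1 (tailVec n r))) (tailVec n i) < 0 := by
  by_contra! hnonneg
  obtain ⟨hmem, hvnonneg, hmax⟩ := hv
  rw [nonnegWeight_apply_fundWeight_iff] at hvnonneg
  have hs : simpleRefl t hi hin * v = v := by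
    refine hmax _ (simpleRefl_mul_mem_minReps hr hmem hi hin hpos.ne') ?_
      (.simpleRefl_mul hr hi hin hpos)
    refine (nonnegWeight_apply_fundWeight_iff _).2 fun j hj hjn => ?_
    change 0 ≤ inner ℝ (refl (simpleRoot t n i) (v.1 (tailVec n r))) (tailVec n j)
    by_cases hji : j = i
    · rwa [hji]
    · rw [inner_refl_left, refl_simpleRoot_tailVec t hi hin hj hjn, if_neg hji, zero_smul, sub_zero]
      exact hvnonneg j hj hjn
  have hfix : refl (simpleRoot t n i) (v.1 (tailVec n r)) = v.1 (tailVec n r) :=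
    congrArg (fun w : weylGroup t n => w.1 (tailVec n r)) hs
  have hself := inner_refl_self (v.1 (tailVec n r)) (simpleRoot t n i)
  rw [hfix] at hself
  linarith

theorem IsSignedSet.exists_int_inner_tailVec {P : Finset ℤ} (hP : IsSignedSet n P) :
    ∃ c : ℤ → ℤ, ∀ j, inner ℝ (epsSum n P) (tailVec n j) = c j := by
  refine ⟨fun j => ∑ a ∈ Finset.Icc j n, if a ∈ P then 1 else if -a ∈ P then -1 else 0,
    fun j => ?_⟩
  rw [tailVec, epsSum.eq_def n (Finset.Icc j n), inner_sum]
  push_cast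
  exact Finset.sum_congr rfl fun a _ => inner_epsSum_eps hP a

/-! ### The coordinates of a maximal weight -/

/-- The conditions satisfied by the sums `c_j = x_j + ⋯ + x_n` of the coordinates of `x = v(ω_r)`,
for maximal `v`: the last two say that `s_i(x)` is not a nonnegative weight if
`⟨x, α_i^∨⟩ > 0`. -/
structure IsTightWalk (n : ℕ) (c : ℤ → ℤ) : Prop where
  nonneg (j : ℤ) : 1 ≤ j → j ≤ n → 0 ≤ c j
  natAbs_sub_le (j : ℤ) : 1 ≤ j → j ≤ n → (c j - c (j + 1)).natAbs ≤ 1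
  last : c (n + 1) = 0
  reflect_one : (1 : ℤ) ≤ n → c 2 < c 1 → 2 * c 2 - c 1 < 0
  reflect (i : ℤ) : 2 ≤ i → i ≤ n → c (i + 1) + c (i - 1) < 2 * c i →
    c (i + 1) + c (i - 1) - c i < 0

theorem IsTightWalk.of_descent {c : ℤ → ℤ} (hc : IsTightWalk n c) {i : ℤ} (hi : 1 ≤ i) (hin : i ≤ n)
    (hdesc : c i - c (i + 1) = 1) : c (i + 1) = 0 ∧ (2 ≤ i → c (i - 1) - c i = -1) := by
  have nonneg {j : ℤ} (hj : 1 ≤ j) (hjn : j ≤ n + 1) : 0 ≤ c j := by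
    rcases eq_or_ne j (n + 1) with rfl | hne
    exacts [hc.last.ge, hc.nonneg j hj (by omega)]
  induction i, hi using Int.leInduction with
  | base =>
    have := nonneg (j := 1 + 1) (by omega) (by omega)
    have := hc.reflect_one hin (by grind)
    grind
  | succ i hi ih =>
    have hreflect := hc.reflect (i + 1) (by omega) hin
    have hstep := hc.natAbs_sub_le i hi (by omega)
    have := nonneg (j := i + 1 + 1) (by omega) (by omega)
    have := ih (by omega)
    rw [add_sub_cancel_right] at hreflect ⊢
    omega

theorem IsTightWalk.eq_zero_or_eq_one {c : ℤ → ℤ} (hc : IsTightWalk n c) {j : ℤ} (hj : 1 ≤ j)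
    (hjn : j ≤ n + 1) : c j = 0 ∨ c j = 1 ∧ c (j + 1) = 0 := by
  induction j, hjn using Int.leInductionDown with
  | base => exact .inl hc.last
  | pred j hjn ih =>
    have hstep := hc.natAbs_sub_le (j - 1) hj (by omega)
    have hnonneg := hc.nonneg (j - 1) hj (by omega)
    have hdesc := hc.of_descent hj (by omega)
    rw [sub_add_cancel] at hstep hdesc ⊢
    rcases ih (by omega) with hzero | ⟨hone, hzero⟩
    · omega
    · have hjn' : j ≠ n + 1 := fun h => by
        have := hc.last
        rw [← h] at this
        omega
      have := (hc.of_descent (i := j) (by omega) (by omega) (by omega)).2 (by omega)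
      omega

theorem inner_refl_tailVec_self {i : ℤ} (hi : 1 ≤ i) (hin : i ≤ n) (x : E n) :
    inner ℝ (refl (simpleRoot t n i) x) (tailVec n i) =
      inner ℝ x (tailVec n i) - inner ℝ x (simpleRoot .C n i) := by
  rw [inner_refl_left, refl_simpleRoot_tailVec t hi hin hi hin, if_pos rfl, one_smul,
    inner_sub_right]

theorem isTightWalk_of_mem_maximalElements {r : ℤ} (hr : 1 ≤ r) {v : weylGroup t n}
    (hv : v ∈ maximalElements t n r) {P : Finset ℤ} (hP : IsSignedSet n P)
    (hvP : v.1 (tailVec n r) = epsSum n P) {c : ℤ → ℤ}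
    (hc : ∀ j, inner ℝ (epsSum n P) (tailVec n j) = c j) : IsTightWalk n c := by
  have inner_eps_eq {i : ℤ} (hin : i ≤ n) :
      inner ℝ (epsSum n P) (eps n i) = (c i - c (i + 1) : ℤ) := by
    rw [eq_sub_of_add_eq (tailVec_eq_eps_add hin).symm, inner_sub_right, hc, hc, Int.cast_sub]
  have inner_simpleRoot_one (h : (1 : ℤ) ≤ n) :
      inner ℝ (epsSum n P) (simpleRoot .C n 1) = (2 * (c 1 - c 2) : ℤ) := by
    rw [simpleRoot, if_pos rfl, real_inner_smul_right, inner_eps_eq h]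
    norm_num
  have inner_simpleRoot {i : ℤ} (hi : 2 ≤ i) (hin : i ≤ n) :
      inner ℝ (epsSum n P) (simpleRoot .C n i) = (2 * c i - (c (i + 1) + c (i - 1)) : ℤ) := by
    rw [simpleRoot, if_neg (by omega), inner_sub_right, inner_eps_eq hin, inner_eps_eq (by omega),
      sub_add_cancel]
    push_cast
    ring
  have descent {i : ℤ} (hi : 1 ≤ i) (hin : i ≤ n) {d : ℤ}
      (hd : inner ℝ (epsSum n P) (simpleRoot .C n i) = d) (hpos : 0 < d) : c i - d < 0 := by
    have hneg := inner_refl_tailVec_neg_of_mem_maximalElements hr hv hi hin (by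
      rw [simpleRoot_eq_smul, real_inner_smul_right] at hd ⊢
      refine mul_pos (rootScale_pos t i) (pos_of_mul_pos_right ?_ (rootScale_pos .C i).le)
      rw [hvP, hd]
      exact_mod_cast hpos)
    rw [inner_refl_tailVec_self hi hin, hvP, hc, hd] at hneg
    exact_mod_cast hneg
  refine ⟨fun j hj hjn => ?_, fun j _ hjn => ?_, ?_, fun hn h => ?_, fun i hi hin h => ?_⟩
  · have := (nonnegWeight_apply_fundWeight_iff _).1 hv.2.1 j hj hjn
    rw [hvP, hc] at this
    exact_mod_cast this
  · have := inner_eps_eq hjn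
    rw [inner_epsSum_eps hP] at this
    split_ifs at this <;> norm_cast at this <;> omega
  · have := hc (n + 1)
    rw [tailVec_of_lt (by omega), inner_zero_right] at this
    exact_mod_cast this.symm
  · have := descent le_rfl hn (inner_simpleRoot_one hn) (by omega)
    omega
  · have := descent (by omega) hin (inner_simpleRoot hi hin) (by omega)
    omega

/-! ### Sums of orthogonal simple roots -/

/-- A finite set of indices of simple roots no two of which are consecutive. -/
def IsGapSet (n : ℕ) (T : Finset ℤ) : Prop :=
  ∀ i ∈ T, 1 ≤ i ∧ i ≤ n ∧ i + 1 ∉ T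

/-- The sum of the simple roots `α_i` of type `B_n` over `i ∈ T`. -/
noncomputable def gapVec (n : ℕ) (T : Finset ℤ) : E n := ∑ i ∈ T, simpleRoot .B n i

/-- The indices `a` of the vectors `ε_a` occurring in `∑_{i ∈ T} (ε_i - ε_{i-1})`, where
`ε_0 = 0`. -/
def signedPairs (T : Finset ℤ) : Finset ℤ := T ∪ (T.erase 1).image (1 - ·)

theorem mem_signedPairs {T : Finset ℤ} {a : ℤ} :
    a ∈ signedPairs T ↔ a ∈ T ∨ a ≠ 0 ∧ 1 - a ∈ T := by
  simp only [signedPairs, Finset.mem_union, Finset.mem_image, Finset.mem_erase]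
  grind

theorem IsGapSet.subset_Icc {T : Finset ℤ} (hT : IsGapSet n T) : T ⊆ Finset.Icc 1 (n : ℤ) :=
  fun i hi => Finset.mem_Icc.2 ⟨(hT i hi).1, (hT i hi).2.1⟩

theorem inner_gapVec_tailVec {T : Finset ℤ} (hT : T ⊆ Finset.Icc 1 (n : ℤ)) {j : ℤ} (hj : 1 ≤ j) :
    inner ℝ (gapVec n T) (tailVec n j) = if j ∈ T then (1 : ℝ) else 0 := by
  have hterm : ∀ i ∈ T, inner ℝ (simpleRoot .B n i) (tailVec n j) = if j = i then (1 : ℝ) else 0 :=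
    fun i hi => by
      have := Finset.mem_Icc.1 (hT hi)
      rw [simpleRoot_eq_smul, rootScale, axisScale, ite_self, one_smul, real_inner_comm,
        inner_tailVec_eps_sub hj this.1 this.2]
  rw [gapVec, sum_inner, Finset.sum_congr rfl hterm, Finset.sum_ite_eq]

theorem gapVec_injOn : Set.InjOn (gapVec n) {T | T ⊆ Finset.Icc 1 (n : ℤ)} := by
  intro S hS T hT h
  ext j
  by_cases hj : 1 ≤ j
  · have := congrArg (inner ℝ · (tailVec n j)) h
    simp only [inner_gapVec_tailVec hS hj, inner_gapVec_tailVec hT hj] at this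
    split_ifs at this <;> simp_all
  · exact iff_of_false (fun h => hj (Finset.mem_Icc.1 (hS h)).1)
      fun h => hj (Finset.mem_Icc.1 (hT h)).1

theorem IsGapSet.isSignedSet {T : Finset ℤ} (hT : IsGapSet n T) :
    IsSignedSet n (signedPairs T) := by
  intro a ha
  simp only [mem_signedPairs] at ha ⊢
  have h (i : ℤ) (hi : i ∈ T) := hT i hi
  grind

theorem IsGapSet.disjoint {T : Finset ℤ} (hT : IsGapSet n T) :
    Disjoint T ((T.erase 1).image (1 - ·)) := by
  refine Finset.disjoint_left.2 fun a ha ha' => ?_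
  obtain ⟨b, hb, rfl⟩ := Finset.mem_image.1 ha'
  have := (hT _ ha).1
  have := (hT _ (Finset.mem_of_mem_erase hb)).1
  have := Finset.ne_of_mem_erase hb
  omega

theorem IsGapSet.card_signedPairs {T : Finset ℤ} (hT : IsGapSet n T) :
    (signedPairs T).card = T.card + (T.erase 1).card := by
  rw [signedPairs, Finset.card_union_of_disjoint hT.disjoint,
    Finset.card_image_of_injective _ sub_right_injective]

theorem IsGapSet.epsSum_signedPairs {T : Finset ℤ} (hT : IsGapSet n T) :
    epsSum n (signedPairs T) = gapVec n T := by
  have hneg : ∑ i ∈ T.erase 1, eps n (1 - i) = ∑ i ∈ T, eps n (1 - i) :=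
    Finset.sum_erase _ (by rw [sub_self, eps_zero])
  rw [epsSum, signedPairs, Finset.sum_union hT.disjoint,
    Finset.sum_image sub_right_injective.injOn, hneg, ← Finset.sum_add_distrib, gapVec]
  refine Finset.sum_congr rfl fun i _ => ?_
  rw [simpleRoot_eq_smul, rootScale, axisScale, ite_self, one_smul, ← neg_sub i 1, eps_neg,
    ← sub_eq_add_neg]

theorem IsGapSet.add_card {r : ℤ} (hr : 1 ≤ r) (hrn : r ≤ n) {v : weylGroup t n} {T : Finset ℤ}
    (hT : IsGapSet n T) (hvT : v.1 (tailVec n r) = gapVec n T) :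
    r + (T.card + (T.erase 1).card : ℕ) = n + 1 := by
  obtain ⟨P, hP, hcard, hvP⟩ := exists_apply_tailVec_eq_epsSum hr hrn v
  rw [hvP, ← hT.epsSum_signedPairs] at hvT
  rwa [← hT.card_signedPairs, ← hP.eq_of_epsSum_eq hT.isSignedSet hvT]

theorem eq_of_subset_of_card_add_card_erase_eq {S T : Finset ℤ} (hST : S ⊆ T)
    (hcard : S.card + (S.erase 1).card = T.card + (T.erase 1).card) : S = T := by
  have := Finset.card_le_card (Finset.erase_subset_erase 1 hST)
  exact Finset.eq_of_subset_of_card_le hST (by omega)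

theorem IsTightWalk.isGapSet {c : ℤ → ℤ} (hc : IsTightWalk n c) :
    IsGapSet n ((Finset.Icc 1 (n : ℤ)).filter (c · = 1)) := by
  intro i hi
  simp only [Finset.mem_filter, Finset.mem_Icc] at hi ⊢
  have := hc.eq_zero_or_eq_one hi.1.1 (by omega)
  omega

theorem exists_isGapSet_of_mem_maximalElements {r : ℤ} (hr : 1 ≤ r) (hrn : r ≤ n)
    {v : weylGroup t n} (hv : v ∈ maximalElements t n r) :
    ∃ T, IsGapSet n T ∧ v.1 (tailVec n r) = gapVec n T := by
  obtain ⟨P, hP, -, hvP⟩ := exists_apply_tailVec_eq_epsSum hr hrn v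
  obtain ⟨c, hc⟩ := hP.exists_int_inner_tailVec
  have walk := isTightWalk_of_mem_maximalElements hr hv hP hvP hc
  refine ⟨_, walk.isGapSet, ext_inner_tailVec fun j hj => ?_⟩
  rw [inner_gapVec_tailVec walk.isGapSet.subset_Icc hj, hvP, hc]
  rcases le_or_gt j n with hjn | hjn
  · rcases walk.eq_zero_or_eq_one hj (by omega) with h | h <;> simp [h, hj, hjn]
  · have := hc j
    rw [tailVec_of_lt hjn, inner_zero_right] at this
    simp [← this, hjn.not_ge]

theorem exists_subset_gapVec_eq {P T : Finset ℤ} (hP : IsSignedSet n P)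
    (hT : T ⊆ Finset.Icc 1 (n : ℤ))
    (h : ∀ j : ℤ, 1 ≤ j → j ≤ n → 0 ≤ inner ℝ (epsSum n P) (tailVec n j) ∧
      inner ℝ (epsSum n P) (tailVec n j) ≤ inner ℝ (gapVec n T) (tailVec n j)) :
    ∃ S ⊆ T, epsSum n P = gapVec n S := by
  obtain ⟨c, hc⟩ := hP.exists_int_inner_tailVec
  have hsub := Finset.filter_subset (c · = 1) T
  refine ⟨_, hsub, ext_inner_tailVec fun j hj => ?_⟩
  rw [inner_gapVec_tailVec (hsub.trans hT) hj]
  rcases le_or_gt j n with hjn | hjn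
  · obtain ⟨hnonneg, hle⟩ := h j hj hjn
    rw [inner_gapVec_tailVec hT hj, hc] at hle
    rw [hc] at hnonneg ⊢
    simp only [Finset.mem_filter]
    norm_cast at hnonneg hle ⊢
    grind
  · rw [tailVec_of_lt hjn, inner_zero_right, if_neg]
    exact fun h => hjn.not_ge (Finset.mem_Icc.1 (hT (hsub h))).2

theorem mem_maximalElements_iff_exists_isGapSet {r : ℕ} (hr : 1 ≤ r) (hrn : r ≤ n)
    {v : weylGroup t n} :
    v ∈ maximalElements t n r ↔
      v ∈ minReps t n r ∧ ∃ T, IsGapSet n T ∧ v.1 (tailVec n r) = gapVec n T := by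
  have hr' : (1 : ℤ) ≤ r := mod_cast hr
  have hrn' : (r : ℤ) ≤ n := mod_cast hrn
  refine ⟨fun hv => ⟨hv.1, exists_isGapSet_of_mem_maximalElements hr' hrn' hv⟩, ?_⟩
  rintro ⟨hv, T, hT, hvT⟩
  refine ⟨hv, (nonnegWeight_apply_fundWeight_iff _).2 fun j hj _ => ?_, fun u hu hunonneg hvu => ?_⟩
  · rw [hvT, inner_gapVec_tailVec hT.subset_Icc hj]
    positivity
  · obtain ⟨P, hP, -, huP⟩ := exists_apply_tailVec_eq_epsSum hr' hrn' u
    obtain ⟨S, hST, hPS⟩ := exists_subset_gapVec_eq hP hT.subset_Icc fun j hj hjn => by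
      rw [← huP, ← hvT]
      exact ⟨(nonnegWeight_apply_fundWeight_iff _).1 hunonneg j hj hjn, hvu.inner_le hr' hj⟩
    have hS : IsGapSet n S := fun i hi =>
      ⟨(hT i (hST hi)).1, (hT i (hST hi)).2.1, fun h => (hT i (hST hi)).2.2 (hST h)⟩
    have hcardS := hS.add_card hr' hrn' (huP.trans hPS)
    have hcardT := hT.add_card hr' hrn' hvT
    refine minReps_ext hr hrn hu hv ?_
    rw [huP, hPS, hvT, eq_of_subset_of_card_add_card_erase_eq hST (by omega)]

/-- The index sets of the weights `v(ω_r)` of the maximal elements `v`, where `r + N = n + 1`: the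
weight `∑_{i ∈ T} (ε_i - ε_{i-1})` has `|T| + |T ∖ {1}|` nonzero coordinates. -/
def gapSets (n N : ℕ) : Set (Finset ℤ) :=
  {T | IsGapSet n T ∧ T.card + (T.erase 1).card = N}

theorem existsUnique_apply_tailVec_eq_gapVec {r N : ℕ} (hr : 1 ≤ r) (hrn : r ≤ n)
    (hN : n + 1 = r + N) {T : Finset ℤ} (hT : T ∈ gapSets n N) :
    ∃! v, v ∈ minReps t n r ∧ v.1 (tailVec n r) = gapVec n T := by
  obtain ⟨v, hv, hvT⟩ := exists_mem_minReps_apply_tailVec_eq t (r := r) (mod_cast hr)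
    hT.1.isSignedSet (by rw [hT.1.card_signedPairs, hT.2]; exact_mod_cast hN.symm)
  rw [hT.1.epsSum_signedPairs] at hvT
  exact ⟨v, ⟨hv, hvT⟩, fun u hu => minReps_ext hr hrn hu.1 hv (hu.2.trans hvT.symm)⟩

theorem mem_maximalElements_iff {r N : ℕ} (hr : 1 ≤ r) (hrn : r ≤ n)
    (hN : n + 1 = r + N) {v : weylGroup t n} : v ∈ maximalElements t n r ↔
      v ∈ minReps t n r ∧ ∃ T ∈ gapSets n N, v.1 (tailVec n r) = gapVec n T := by
  rw [mem_maximalElements_iff_exists_isGapSet hr hrn]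
  refine and_congr_right fun _ => exists_congr fun T => ?_
  constructor
  · rintro ⟨hT, hvT⟩
    have := hT.add_card (mod_cast hr) (mod_cast hrn) hvT
    exact ⟨⟨hT, by omega⟩, hvT⟩
  · rintro ⟨hT, hvT⟩
    exact ⟨hT.1, hvT⟩

theorem IsGapSet.isWindow_append {r : ℕ} (hr : 1 ≤ r) (hrn : r ≤ n) {v : weylGroup t n}
    (hv : v ∈ minReps t n r) {T : Finset ℤ} (hT : IsGapSet n T)
    (hvT : v.1 (tailVec n r) = gapVec n T) {l l' : List ℤ} (hl : l.SortedLT) (hl' : l'.SortedLT)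
    (hmem : ∀ a, a ∈ l ↔ 1 ≤ a ∧ a ≤ n ∧ a ∉ T ∧ a + 1 ∉ T)
    (hmem' : ∀ a, a ∈ l' ↔ a ∈ T ∨ a ≠ 0 ∧ 1 - a ∈ T) : IsWindow v (l ++ l') := by
  refine TypeBC.isWindow_append hr hrn hv hT.isSignedSet
    (hvT.trans hT.epsSum_signedPairs.symm) hl hl' (fun a => ?_)
    fun a => (hmem' a).trans mem_signedPairs.symm
  have h (i : ℤ) (hi : i ∈ T) := hT i hi
  rw [hmem, mem_signedPairs, mem_signedPairs]
  grind

/-! ### Windows -/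

theorem mem_predSeq {i : List ℤ} {a : ℤ} : a ∈ predSeq i ↔ a + 1 ∈ i := by
  simp [predSeq, sub_eq_iff_eq_add]

theorem mem_negRev {i : List ℤ} {a : ℤ} : a ∈ negRev i ↔ -a ∈ i := by
  simp [negRev, neg_eq_iff_eq_neg]

theorem sortedLT_negRev_predSeq_append {i j : List ℤ} (hi : i.SortedLT) (hj : j.SortedLT)
    (hi' : ∀ x ∈ i, 2 ≤ x) (hj' : ∀ x ∈ j, 1 ≤ x) : (negRev (predSeq i) ++ j).SortedLT := by
  refine (List.pairwise_append.2 ⟨?_, hj.pairwise, fun a ha b hb => ?_⟩).sortedLT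
  · rw [negRev, predSeq, List.pairwise_reverse, List.map_map, List.pairwise_map]
    exact hi.pairwise.imp fun h => neg_lt_neg (sub_lt_sub_right h 1)
  · have := hi' _ (mem_predSeq.1 (mem_negRev.1 ha))
    have := hj' b hb
    omega

theorem sortedLT_of_mem_gapSeqs {m : ℕ} {s e : ℤ} {i : List ℤ} (hi : i ∈ gapSeqs m s e) :
    i.SortedLT :=
  (hi.2.2.imp fun _ _ h => by omega).sortedLT

theorem add_one_notMem_of_mem_gapSeqs {m : ℕ} {s e : ℤ} {i : List ℤ} (hi : i ∈ gapSeqs m s e)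
    {x : ℤ} (hx : x ∈ i) : x + 1 ∉ i := fun hx' => by
  have : IsTrans ℤ fun x y => 2 ≤ y - x := ⟨fun _ _ _ _ _ => by omega⟩
  have : Std.Symm fun x y : ℤ => y ≠ x + 1 ∧ x ≠ y + 1 := ⟨fun _ _ h => h.symm⟩
  have hne : i.Pairwise fun x y => y ≠ x + 1 ∧ x ≠ y + 1 :=
    (List.isChain_iff_pairwise.1 hi.2.2).imp fun _ => by omega
  exact (hne.forall hx hx' (by omega)).1 rfl

theorem sort_mem_gapSeqs {T : Finset ℤ} {s e : ℤ} (hT : ∀ x ∈ T, s ≤ x ∧ x ≤ e ∧ x + 1 ∉ T) :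
    T.sort ∈ gapSeqs T.card s e := by
  refine ⟨T.length_sort _, fun x hx => ?_, List.Pairwise.isChain <|
    (Finset.sortedLT_sort T).pairwise.imp_of_mem fun {a b} ha hb hab => ?_⟩
  · have := hT x ((Finset.mem_sort _).1 hx)
    omega
  · rw [Finset.mem_sort] at ha hb
    have : b ≠ a + 1 := fun h => (hT a ha).2.2 (h ▸ hb)
    omega

theorem bijOn_toFinset_gapSeqs (m : ℕ) (s e : ℤ) : Set.BijOn List.toFinset (gapSeqs m s e)
    {T | (∀ x ∈ T, s ≤ x ∧ x ≤ e ∧ x + 1 ∉ T) ∧ T.card = m} := by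
  refine ⟨fun i hi => ⟨fun x hx => ?_, ?_⟩, fun i hi j hj h => ?_, fun T hT => ?_⟩
  · rw [List.mem_toFinset] at hx ⊢
    exact ⟨(hi.2.1 x hx).1, (hi.2.1 x hx).2, add_one_notMem_of_mem_gapSeqs hi hx⟩
  · rw [List.toFinset_card_of_nodup (sortedLT_of_mem_gapSeqs hi).nodup, hi.1]
  · refine (sortedLT_of_mem_gapSeqs hi).eq_of_mem_iff (sortedLT_of_mem_gapSeqs hj) fun a => ?_
    rw [← List.mem_toFinset, h, List.mem_toFinset]
  · exact ⟨_, hT.2 ▸ sort_mem_gapSeqs hT.1, T.sort_toFinset _⟩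

theorem bijOn_toFinset_gapSets (n m : ℕ) :
    Set.BijOn List.toFinset (gapSeqs m 2 n) (gapSets n (2 * m)) := by
  convert bijOn_toFinset_gapSeqs m 2 n using 1
  ext T
  constructor
  · rintro ⟨hT, hcard⟩
    have h1 : 1 ∉ T := fun h => by
      have := Finset.card_erase_add_one h
      omega
    rw [Finset.erase_eq_of_notMem h1] at hcard
    refine ⟨fun x hx => ⟨?_, (hT x hx).2⟩, by omega⟩
    have : x ≠ 1 := fun h => h1 (h ▸ hx)
    have := (hT x hx).1
    omega
  · rintro ⟨hT, rfl⟩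
    have h1 : 1 ∉ T := fun h => absurd (hT 1 h).1 (by norm_num)
    exact ⟨fun x hx => ⟨by have := (hT x hx).1; omega, (hT x hx).2⟩,
      by rw [Finset.erase_eq_of_notMem h1, two_mul]⟩

theorem bijOn_insert_one_toFinset_gapSets (hn : 1 ≤ n) (m : ℕ) :
    Set.BijOn (fun i : List ℤ => insert 1 i.toFinset) (gapSeqs m 3 n) (gapSets n (2 * m + 1)) := by
  refine Set.BijOn.comp (g := insert 1) ?_ (bijOn_toFinset_gapSeqs m 3 n)
  have one_notMem {T : Finset ℤ} (hT : ∀ x ∈ T, 3 ≤ x ∧ x ≤ n ∧ x + 1 ∉ T) : 1 ∉ T :=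
    fun h => absurd (hT 1 h).1 (by norm_num)
  refine ⟨?_, fun S hS T hT h => ?_, ?_⟩
  · rintro T ⟨hT, rfl⟩
    refine ⟨fun x hx => ?_, ?_⟩
    · have h (y : ℤ) (hy : y ∈ T) := hT y hy
      grind
    · rw [Finset.erase_insert (one_notMem hT), Finset.card_insert_of_notMem (one_notMem hT)]
      omega
  · rw [← Finset.erase_insert (one_notMem hS.1), h, Finset.erase_insert (one_notMem hT.1)]
  · rintro T ⟨hT, hcard⟩
    have h1 : 1 ∈ T := by
      by_contra h
      rw [Finset.erase_eq_of_notMem h] at hcard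
      omega
    have := Finset.card_erase_add_one h1
    refine ⟨T.erase 1, ⟨fun x hx => ?_, by omega⟩, Finset.insert_erase h1⟩
    have h2 := (hT 1 h1).2.2
    obtain ⟨hne, hx⟩ := Finset.mem_erase.1 hx
    have := hT x hx
    have : x ≠ 1 + 1 := fun h => h2 (h ▸ hx)
    exact ⟨by omega, (hT x hx).2.1, fun h => (hT x hx).2.2 (Finset.mem_of_mem_erase h)⟩

theorem isWindow_windowEven {r m : ℕ} (hr : 1 ≤ r) (hrn : r ≤ n) {i : List ℤ}
    (hi : i ∈ gapSeqs m 2 n) {v : weylGroup t n} (hv : v ∈ minReps t n r)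
    (h : v.1 (tailVec n r) = gapVec n i.toFinset) : IsWindow v (windowEven n i) := by
  have hlt := sortedLT_of_mem_gapSeqs hi
  rw [windowEven, List.append_assoc]
  refine ((bijOn_toFinset_gapSets n m).mapsTo hi).1.isWindow_append hr hrn hv h
    (Finset.sortedLT_sort _) (sortedLT_negRev_predSeq_append hlt hlt (fun x hx => (hi.2.1 x hx).1)
      fun x hx => by linarith [hi.2.1 x hx]) (fun a => ?_) fun a => ?_
  · simp only [Finset.mem_sort, Finset.mem_sdiff, Finset.mem_Icc, Finset.mem_union,
      List.mem_toFinset, mem_predSeq]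
    tauto
  · have := hi.2.1 (1 - a)
    rw [List.mem_append, mem_negRev, mem_predSeq, neg_add_eq_sub, List.mem_toFinset,
      List.mem_toFinset]
    grind

theorem isWindow_windowOdd {r m : ℕ} (hr : 1 ≤ r) (hrn : r ≤ n) {i : List ℤ}
    (hi : i ∈ gapSeqs m 3 n) {v : weylGroup t n} (hv : v ∈ minReps t n r)
    (h : v.1 (tailVec n r) = gapVec n (insert 1 i.toFinset)) : IsWindow v (windowOdd n i) := by
  have hlt := sortedLT_of_mem_gapSeqs hi
  have hlt' : (1 :: i).SortedLT :=
    (List.pairwise_cons.2 ⟨fun x hx => by linarith [hi.2.1 x hx], hlt.pairwise⟩).sortedLT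
  rw [windowOdd, List.append_assoc, List.append_assoc, List.singleton_append]
  have hgap := ((bijOn_insert_one_toFinset_gapSets (hr.trans hrn) m).mapsTo hi).1
  refine hgap.isWindow_append hr hrn hv h (Finset.sortedLT_sort _)
    (sortedLT_negRev_predSeq_append hlt hlt' (fun x hx => by linarith [hi.2.1 x hx])
      fun x hx => ?_) (fun a => ?_) fun a => ?_
  · have := hi.2.1 x
    grind
  · simp only [Finset.mem_sort, Finset.mem_sdiff, Finset.mem_Icc, Finset.mem_union,
      Finset.mem_insert, Finset.mem_singleton, List.mem_toFinset, mem_predSeq]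
    grind
  · have := hi.2.1 a
    have := hi.2.1 (1 - a)
    simp only [List.mem_append, mem_negRev, mem_predSeq, neg_add_eq_sub, List.mem_cons,
      Finset.mem_insert, List.mem_toFinset]
    grind

theorem rootSum_eq_gapVec {m : ℕ} {s e : ℤ} (hs : 2 ≤ s) {i : List ℤ} (hi : i ∈ gapSeqs m s e) :
    rootSum t n i = gapVec n i.toFinset := by
  rw [gapVec, List.sum_toFinset _ (sortedLT_of_mem_gapSeqs hi).nodup, rootSum]
  refine congrArg _ (List.map_congr_left fun x hx => ?_)
  have := hi.2.1 x hx
  rw [simpleRoot.eq_def, simpleRoot.eq_def, if_neg (by omega), if_neg (by omega)]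

theorem alphaOneCoeff_smul_add_rootSum {m : ℕ} {e : ℤ} {i : List ℤ} (hi : i ∈ gapSeqs m 3 e) :
    alphaOneCoeff t • simpleRoot t n 1 + rootSum t n i = gapVec n (insert 1 i.toFinset) := by
  have h1 : 1 ∉ i.toFinset := fun h => absurd (hi.2.1 1 (List.mem_toFinset.1 h)).1 (by norm_num)
  rw [rootSum_eq_gapVec (by norm_num) hi, gapVec, gapVec, Finset.sum_insert h1]
  cases t <;> simp [alphaOneCoeff, simpleRoot, smul_smul]

theorem maximalElements_of_bijOn {r N : ℕ} (hr : 2 ≤ r) (hrn : r ≤ n) (hN : n + 1 = r + N)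
    {ι : Type*} {J : Set ι} {F : ι → Finset ℤ} (hF : Set.BijOn F J (gapSets n N)) {x : ι → E n}
    (hx : ∀ i ∈ J, x i = gapVec n (F i)) {l : ι → List ℤ}
    (hl : ∀ i ∈ J, ∀ v ∈ minReps t n r, v.1 (tailVec n r) = gapVec n (F i) → IsWindow v (l i)) :
    (∀ i ∈ J, ∃ v ∈ maximalElements t n r, v.1 (fundWeight t n r) = x i ∧ IsWindow v (l i) ∧
      ∀ u ∈ minReps t n r, u.1 (fundWeight t n r) = x i → u = v) ∧
    ∀ v ∈ maximalElements t n r, ∃! i, i ∈ J ∧ v.1 (fundWeight t n r) = x i := by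
  have hr' : 1 ≤ r := by omega
  rw [fundWeight_eq_smul, weightScale_of_ne_one (by omega), one_smul]
  refine ⟨fun i hi => ?_, fun v hv => ?_⟩
  · rw [hx i hi]
    obtain ⟨v, ⟨hv, hvi⟩, huniq⟩ := existsUnique_apply_tailVec_eq_gapVec hr' hrn hN (hF.mapsTo hi)
    exact ⟨v, (mem_maximalElements_iff hr' hrn hN).2 ⟨hv, _, hF.mapsTo hi, hvi⟩, hvi,
      hl i hi v hv hvi, fun u hu hui => huniq u ⟨hu, hui⟩⟩
  · obtain ⟨-, T, hT, hvT⟩ := (mem_maximalElements_iff hr' hrn hN).1 hv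
    obtain ⟨i, hi, rfl⟩ := hF.surjOn hT
    refine ⟨i, ⟨hi, hvT.trans (hx i hi).symm⟩, fun j ⟨hj, hvj⟩ => hF.injOn hj hi ?_⟩
    exact gapVec_injOn (hF.mapsTo hj).1.subset_Icc (hF.mapsTo hi).1.subset_Icc
      ((hx j hj).symm.trans (hvj.symm.trans hvT))

theorem exists_maximalElements_eq_singleton {r N : ℕ} (hr : 1 ≤ r) (hrn : r ≤ n)
    (hN : n + 1 = r + N) {T : Finset ℤ} (hT : gapSets n N = {T}) {l l' : List ℤ} (hl : l.SortedLT)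
    (hl' : l'.SortedLT) (hmem : ∀ a, a ∈ l ↔ 1 ≤ a ∧ a ≤ n ∧ a ∉ T ∧ a + 1 ∉ T)
    (hmem' : ∀ a, a ∈ l' ↔ a ∈ T ∨ a ≠ 0 ∧ 1 - a ∈ T) :
    ∃ v : weylGroup t n, maximalElements t n r = {v} ∧ IsWindow v (l ++ l') := by
  have hmemT : T ∈ gapSets n N := hT ▸ Set.mem_singleton T
  obtain ⟨v, ⟨hv, hvT⟩, huniq⟩ := existsUnique_apply_tailVec_eq_gapVec (t := t) hr hrn hN hmemT
  refine ⟨v, Set.eq_singleton_iff_unique_mem.2 ⟨?_, fun u hu => ?_⟩,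
    hmemT.1.isWindow_append hr hrn hv hvT hl hl' hmem hmem'⟩
  · exact (mem_maximalElements_iff hr hrn hN).2 ⟨hv, T, hmemT, hvT⟩
  · obtain ⟨hu, U, hU, huU⟩ := (mem_maximalElements_iff hr hrn hN).1 hu
    rw [hT, Set.mem_singleton_iff] at hU
    exact huniq u ⟨hu, hU ▸ huU⟩

theorem IsGapSet.card_add_card_erase_eq_iff {T : Finset ℤ} (hT : IsGapSet n T) :
    T.card + (T.erase 1).card = n ↔ ∀ k : ℤ, 1 ≤ k → k ≤ n → k ∈ T ∨ k + 1 ∈ T := by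
  have hmem (k : ℤ) : k ∈ (T.erase 1).image (· - 1) ↔ k ≠ 0 ∧ k + 1 ∈ T := by
    simp only [Finset.mem_image, Finset.mem_erase]
    grind
  have hdisj : Disjoint T ((T.erase 1).image (· - 1)) :=
    Finset.disjoint_left.2 fun k hk hk' => (hT k hk).2.2 ((hmem k).1 hk').2
  have hsub : T ∪ (T.erase 1).image (· - 1) ⊆ Finset.Icc 1 (n : ℤ) := fun k hk => by
    rw [Finset.mem_union, hmem] at hk
    have := hT k
    have := hT (k + 1)
    grind
  have hIcc : (Finset.Icc 1 (n : ℤ)).card = n := by simp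
  rw [← Finset.card_image_of_injective (T.erase 1) (sub_left_injective (b := (1 : ℤ))),
    ← Finset.card_union_of_disjoint hdisj]
  refine ⟨fun h k hk hk' => ?_, fun h => ?_⟩
  · have hmem_union : k ∈ T ∪ (T.erase 1).image (· - 1) := by
      rw [Finset.eq_of_subset_of_card_le hsub (by omega)]
      exact Finset.mem_Icc.2 ⟨hk, hk'⟩
    rw [Finset.mem_union, hmem] at hmem_union
    exact hmem_union.imp_right And.right
  · rw [hsub.antisymm fun k hk => ?_, hIcc]
    obtain ⟨hk, hk'⟩ := Finset.mem_Icc.1 hk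
    rw [Finset.mem_union, hmem]
    exact (h k hk hk').imp_right fun hk => ⟨by omega, hk⟩

theorem gapSets_self (n : ℕ) :
    gapSets n n = {(Finset.Icc 1 (n : ℤ)).filter fun a : ℤ => 2 ∣ n - a} := by
  refine Set.eq_singleton_iff_unique_mem.2 ⟨?_, ?_⟩
  · have hgap : IsGapSet n ((Finset.Icc 1 (n : ℤ)).filter fun a => 2 ∣ n - a) := fun i hi => by
      simp only [Finset.mem_filter, Finset.mem_Icc] at hi ⊢
      omega
    refine ⟨hgap, hgap.card_add_card_erase_eq_iff.2 fun k hk hk' => ?_⟩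
    simp only [Finset.mem_filter, Finset.mem_Icc]
    omega
  · rintro T ⟨hT, hcard⟩
    have hcover := hT.card_add_card_erase_eq_iff.1 hcard
    have mem_iff (k : ℤ) (hk : k ≤ n + 1) : 1 ≤ k → (k ∈ T ↔ 2 ∣ n - k) := by
      induction k, hk using Int.leInductionDown with
      | base => exact fun _ => iff_of_false (fun h => by have := hT _ h; omega) (by omega)
      | pred k hk ih =>
        intro hk'
        have := hcover (k - 1) hk' (by omega)
        have := hT (k - 1)
        have := ih (by omega)
        rw [sub_add_cancel] at *
        grind
    ext k
    simp only [Finset.mem_filter, Finset.mem_Icc]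
    have := hT k
    have := mem_iff k
    grind

theorem gapSets_one (hn : 1 ≤ n) : gapSets n 1 = {{1}} := by
  refine Set.eq_singleton_iff_unique_mem.2 ⟨⟨fun i hi => ?_, by simp⟩, ?_⟩
  · obtain rfl := Finset.mem_singleton.1 hi
    exact ⟨le_rfl, mod_cast hn, by simp⟩
  · rintro T ⟨-, hcard⟩
    have hcard_pos : 0 < T.card := by
      have := Finset.card_erase_le (s := T) (a := 1)
      omega
    have herase : T.erase 1 = ∅ := Finset.card_eq_zero.1 (by omega)
    exact ((Finset.erase_eq_empty_iff ..).1 herase).resolve_left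
      (Finset.card_pos.1 hcard_pos).ne_empty

theorem sortedLT_map_range {f : ℕ → ℤ} (hf : StrictMono f) (p : ℕ) :
    ((List.range p).map f).SortedLT :=
  (List.pairwise_map.2 (List.pairwise_lt_range.imp fun h => hf h)).sortedLT

theorem exists_maximalElements_one_eq_singleton {p q : ℕ} {e : ℤ} (hn : 1 ≤ n) (he : 1 ≤ e)
    (he' : e ≤ 2) (hpq : n = p + q) (hq : n + 2 = 2 * q + e) :
    ∃ v : weylGroup t n, maximalElements t n (1 : ℕ) = {v} ∧
      IsWindow v (((List.range p).map fun k : ℕ => -((n : ℤ) - 1) + 2 * (k : ℤ)) ++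
        (List.range q).map fun k : ℕ => 2 * (k : ℤ) + e) := by
  refine exists_maximalElements_eq_singleton (l := []) (l' := _ ++ _) le_rfl hn (add_comm n 1)
    (gapSets_self n) List.Pairwise.nil.sortedLT
    (List.pairwise_append.2 ⟨?_, ?_, ?_⟩).sortedLT (fun a => ?_) fun a => ?_
  · exact (sortedLT_map_range (fun _ _ _ => by omega) p).pairwise
  · exact (sortedLT_map_range (fun _ _ _ => by omega) q).pairwise
  · simp only [List.mem_map, List.mem_range]
    rintro a ⟨k, hk, rfl⟩ b ⟨j, hj, rfl⟩
    omega
  · simp only [List.not_mem_nil, false_iff, Finset.mem_filter, Finset.mem_Icc]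
    omega
  · simp only [List.mem_append, List.mem_map, List.mem_range, Finset.mem_filter, Finset.mem_Icc]
    constructor
    · rintro (⟨k, hk, rfl⟩ | ⟨k, hk, rfl⟩) <;> omega
    · rintro (h | h)
      · exact .inr ⟨((a - e) / 2).toNat, by omega, by omega⟩
      · exact .inl ⟨((a + n - 1) / 2).toNat, by omega, by omega⟩

theorem exists_maximalElements_last_eq_singleton (hn : 1 ≤ n) :
    ∃ v : weylGroup t n, maximalElements t n n = {v} ∧
      IsWindow v (((List.range (n - 1)).map fun k : ℕ => (k : ℤ) + 2) ++ [1]) := by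
  refine exists_maximalElements_eq_singleton hn le_rfl rfl (gapSets_one hn)
    (sortedLT_map_range (fun _ _ _ => by omega) _) (List.pairwise_singleton _ _).sortedLT
    (fun a => ?_) fun a => ?_
  · simp only [List.mem_map, List.mem_range, Finset.mem_singleton]
    exact ⟨by rintro ⟨k, hk, rfl⟩; omega, fun h => ⟨(a - 2).toNat, by omega, by omega⟩⟩
  · simp only [List.mem_singleton, Finset.mem_singleton]
    omega

end TypeBC

open TypeBC in
theorem proposition4p1 (t : Kind) (n r : ℕ) (hr : 1 ≤ r) (hrn : r ≤ n) :
    -- the case `r = 1`, `n = 2p` even: `(-(n-1), -(n-3), …, -1, 2, 4, …, n)`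
    (∀ p : ℕ, r = 1 → n = 2 * p →
      ∃ v : weylGroup t n, maximalElements t n r = {v} ∧
        IsWindow v
          (((List.range p).map fun k : ℕ => -((n : ℤ) - 1) + 2 * (k : ℤ)) ++
            (List.range p).map fun k : ℕ => 2 * (k : ℤ) + 2)) ∧
    -- the case `r = 1`, `n = 2p + 1` odd: `(-(n-1), -(n-3), …, -2, 1, 3, …, n)`
    (∀ p : ℕ, r = 1 → n = 2 * p + 1 →
      ∃ v : weylGroup t n, maximalElements t n r = {v} ∧
        IsWindow v
          (((List.range p).map fun k : ℕ => -((n : ℤ) - 1) + 2 * (k : ℤ)) ++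
            (List.range (p + 1)).map fun k : ℕ => 2 * (k : ℤ) + 1)) ∧
    -- the case `2 ≤ r ≤ n - 1`, `n + 1 - r = 2m`
    (∀ m : ℕ, 2 ≤ r → r < n → n + 1 = r + 2 * m →
      (∀ i ∈ gapSeqs m 2 n, ∃ v ∈ maximalElements t n r,
        v.1 (fundWeight t n r) = rootSum t n i ∧
        IsWindow v (windowEven n i) ∧
        ∀ u ∈ minReps t n r, u.1 (fundWeight t n r) = rootSum t n i → u = v) ∧
      ∀ v ∈ maximalElements t n r,
        ∃! i : List ℤ, i ∈ gapSeqs m 2 n ∧ v.1 (fundWeight t n r) = rootSum t n i) ∧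
    -- the case `2 ≤ r ≤ n - 1`, `n + 1 - r = 2m + 1`
    (∀ m : ℕ, 2 ≤ r → r < n → n + 1 = r + (2 * m + 1) →
      (∀ i ∈ gapSeqs m 3 n, ∃ v ∈ maximalElements t n r,
        v.1 (fundWeight t n r) = alphaOneCoeff t • simpleRoot t n 1 + rootSum t n i ∧
        IsWindow v (windowOdd n i) ∧
        ∀ u ∈ minReps t n r,
          u.1 (fundWeight t n r) = alphaOneCoeff t • simpleRoot t n 1 + rootSum t n i → u = v) ∧
      ∀ v ∈ maximalElements t n r,
        ∃! i : List ℤ, i ∈ gapSeqs m 3 n ∧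
          v.1 (fundWeight t n r) = alphaOneCoeff t • simpleRoot t n 1 + rootSum t n i) ∧
    -- the case `r = n`: `(2, 3, …, n, 1)`
    (r = n →
      ∃ v : weylGroup t n, maximalElements t n r = {v} ∧
        IsWindow v (((List.range (n - 1)).map fun k : ℕ => (k : ℤ) + 2) ++ [1])) := by
  refine ⟨fun p h1 hn => ?_, fun p h1 hn => ?_, fun m h2 _ hN => ?_, fun m h2 _ hN => ?_,
    fun hr' => ?_⟩
  · subst h1
    exact exists_maximalElements_one_eq_singleton (p := p) (q := p) (e := 2) hrn (by norm_num)
      le_rfl (by omega) (by omega)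
  · subst h1
    exact exists_maximalElements_one_eq_singleton (p := p) (q := p + 1) (e := 1) hrn le_rfl
      (by norm_num) (by omega) (by omega)
  · exact maximalElements_of_bijOn h2 hrn hN (bijOn_toFinset_gapSets n m)
      (fun i hi => rootSum_eq_gapVec le_rfl hi)
      fun i hi v hv h => isWindow_windowEven hr hrn hi hv h
  · exact maximalElements_of_bijOn h2 hrn hN (bijOn_insert_one_toFinset_gapSets (hr.trans hrn) m)
      (fun i hi => alphaOneCoeff_smul_add_rootSum hi)
      fun i hi v hv h => isWindow_windowOdd hr hrn hi hv h
  · subst hr'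
    exact exists_maximalElements_last_eq_singleton hr
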